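/- **Definitions.** A code $C$ of length $n$ over $\mathbb F_4$ is a linear subspace of $\mathbb F_4^n$. It is of Type IV if all its weights are even and $C=\{y\in\mathbb F_4^n : \sum_i x_iy_i^2=0 \text{ for all } x\in C\}$ (Hermitian self-duality). It is extremal if moreover its minimum distance is $2\lfloor n/6\rfloor+2$. For a nonzero weight $w$ occurring in $C$, the support design $D_w$ has the $n$ coordinates as points, and its blocks are the supports of the codewords of weight $w$, one block for each codeword (repeated blocks are allowed). $D_w$ is a $t$-design if $t\le w$ and every $t$ points lie in the same number $\lambda>0$ of blocks, counted with multiplicity. $D_w$ is trivial if all $w$-subsets of the points occur equally often as blocks. Put $$\delta(C)=\max\{t\in\mathbb N : D_w \text{ is a } t\text{-design for every nonzero weight } w \text{ occurring in } C\},$$ $$s(C)=\max\{t\in\mathbb N : D_w \text{ is a } t\text{-design for some nonzero weight } w \text{ such that } D_w \text{ is nontrivial}\}.$$ **Theorem 1.2.** Let $C$ be an extremal Type IV code of length $n$, and let $m\ge 1$ be an integer. In each case below both maxima exist, and their values are as follows. 1. Assume that $n=6m$ and $m\ne 1,2$. - (a) If $m\notin\{10,15\}$, then $\delta(C)=s(C)=5$.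 - (b) If $m\in\{10,15\}$, then $\delta(C)=s(C)=5$ or $\delta(C)=s(C)=7$. 2. Assume that $n=6m+2$. - (a) If $m\neq 11$, then $\delta(C)=s(C)=3$. - (b) If $m=11$, then $\delta(C)=s(C)\in\{3,5,6,7\}$. 3. Assume that $n=6m+4$. - (a) If $m\in\{1,2,4,13\}$, then $\delta(C)=s(C)=1$. - (b) If $m\in\{3,5,6,7,8,10,11,12,15,16,17,18,20,21\}$, then $\delta(C)=s(C)\in\{1,3\}$. - (c) If $m=9$, then $\delta(C)=s(C)\in\{1,3,4\}$. - (d) If $m\in\{14,19\}$, then $\delta(C)=s(C)\in\{1,3,4,5\}$. -/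

import Mathlib

open scoped Classical

noncomputable section

namespace TypeIV

/-- A block design, given by its collection of blocks (a multiset, so repeated blocks are
allowed), is a `t`-design with blocks of size `k` if `t ≤ k`, all blocks have `k` points, and
any `t` points lie in the same positive number `lam` of blocks, counted with multiplicity. -/
def IsTDesign {X : Type*} [Fintype X] (t k : ℕ) (B : Multiset (Finset X)) : Prop :=
  t ≤ k ∧ (∀ b ∈ B, b.card = k) ∧
    ∃ lam : ℕ, 0 < lam ∧ ∀ T : Finset X, T.card = t → (B.filter (fun b => T ⊆ b)).card = lam

/-- The design with block size `k` is trivial: every `k`-subset of the points is a block the same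
number of times (possibly zero). -/
def IsTrivialDesign {X : Type*} [Fintype X] (k : ℕ) (B : Multiset (Finset X)) : Prop :=
  ∃ mu : ℕ, ∀ S : Finset X, S.card = k → B.count S = mu

variable {F : Type*} [Field F] {n : ℕ}

/-- The Hermitian inner product on `F₄ ^ n`. -/
def hermitianInner (x y : Fin n → F) : F := ∑ i, x i * y i ^ 2

/-- The Hermitian dual of a code. -/
def hermitianDual (C : Submodule F (Fin n → F)) : Set (Fin n → F) :=
  {y | ∀ x ∈ C, hermitianInner x y = 0}

/-- The support of a vector. -/
def supp (x : Fin n → F) : Finset (Fin n) := Finset.univ.filter (fun i => x i ≠ 0)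

/-- `d` is the minimum distance of `C`, i.e. the least weight of a nonzero codeword. -/
def IsMinDist (C : Submodule F (Fin n → F)) (d : ℕ) : Prop :=
  IsLeast {w | ∃ x ∈ C, x ≠ 0 ∧ hammingNorm x = w} d

/-- Type IV codes: Hermitian self-dual with all weights even (`F` is the field of four
elements). -/
def IsTypeIV (C : Submodule F (Fin n → F)) : Prop :=
  (C : Set (Fin n → F)) = hermitianDual C ∧ ∀ x ∈ C, 2 ∣ hammingNorm x

/-- Extremal Type IV codes: the minimum distance is `2 ⌊n / 6⌋ + 2`. -/
def IsExtremalTypeIV (C : Submodule F (Fin n → F)) : Prop :=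
  IsTypeIV C ∧ IsMinDist C (2 * (n / 6) + 2)

/-- The blocks of the support design `D_w`: the supports of the codewords of weight `w`, each
codeword contributing one block. -/
def supportDesign [Fintype F] (C : Submodule F (Fin n → F)) (w : ℕ) :
    Multiset (Finset (Fin n)) :=
  (Finset.univ.filter (fun x : Fin n → F => x ∈ C ∧ hammingNorm x = w)).val.map supp

/-- `δ(C) = v`: the largest `t` such that `D_w` is a `t`-design for every nonzero weight `w`
occurring in `C` is `v`. -/
def DeltaEq [Fintype F] (C : Submodule F (Fin n → F)) (v : ℕ) : Prop :=
  IsGreatest {t : ℕ | ∀ w : ℕ, 0 < w → (∃ x ∈ C, hammingNorm x = w) →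
    IsTDesign t w (supportDesign C w)} v

/-- `s(C) = v`: the largest `t` such that some nontrivial support design `D_w`, `w > 0`, is a
`t`-design is `v`. -/
def SEq [Fintype F] (C : Submodule F (Fin n → F)) (v : ℕ) : Prop :=
  IsGreatest {t : ℕ | ∃ w : ℕ, 0 < w ∧ ¬ IsTrivialDesign w (supportDesign C w) ∧
    IsTDesign t w (supportDesign C w)} v

/-- `δ(C) = s(C) = v`. -/
def DeltaSEq [Fintype F] (C : Submodule F (Fin n → F)) (v : ℕ) : Prop :=
  DeltaEq C v ∧ SEq C v

end TypeIV

end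

noncomputable section

namespace TypeIV

open Finset

/-! ### Regular weights, designs, and trivial designs. -/

section

variable {F : Type*} [Field F] [Fintype F] {n : ℕ}

/-! Suppose all weights are regular for every size below t, and compare two t-sets T and T'. The
MacWilliams identity, applied to the codewords whose support contains T, involves the subsets of T;
in the difference between T and T' all proper subsets cancel. After division by (xy)^t this
difference is a form of degree n - 2t that the MacWilliams transformation multiplies by (-1)^t
(`enum_sub_transform`, `diffPoly_mobiusInv`). The minimum distance d makes it divisible by y^(d-t),
and since all weights are even it is then divisible by (y(x^2 - y^2))^(d-t). The quotient has degree
r = n + t - 3d.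

Everything depends on r. If r < 0 or r = 1 the quotient is zero, so regularity in size t is
automatic (`regular_of_add_lt`, `regular_of_add_eq`). If r is 0, 2, 3 or 4 it is a scalar multiple
of an explicit form (`diffPoly_eq`). The coefficients of the resulting product at the relevant
weights do not vanish (for r = 4 this is checked only for the three exponents needed), so a single
regular weight kills the scalar and makes every weight regular (`regular_of_regular`). Weights above
n - t give trivial designs. Hence δ and s agree, and both are decided by the minimum weight alone
(`deltaSEq_of_regular`, `deltaSEq_ladder`).

It remains to show that the minimum weight words fail to be regular in some size. The number of
these words follows from a Lagrange inversion argument for invariants (`coeff_invariant`), and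
regularity would impose a divisibility, sharpened by a factor 3 from scalar multiples, that fails in
the listed cases (`not_regular_of_not_dvd`). For lengths 6m and 6m + 2 only finitely many m occur,
since the number of words of the next weight would otherwise be negative (`lt_of_isMinDist_six_mul`,
`lt_of_isMinDist_six_mul_add_two`). Length 16 passes the divisibility test and is excluded by a
study of intersecting blocks (`not_regular_sixteen`). -/

/-- The number of codewords of weight `w` whose support contains `T`. -/
def cnt (C : Submodule F (Fin n → F)) (w : ℕ) (T : Finset (Fin n)) : ℕ :=
  #{x : Fin n → F | x ∈ C ∧ hammingNorm x = w ∧ T ⊆ supp x}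

/-- The number of codewords of weight `w` whose support contains a `t`-set depends only
on `t`. -/
def Regular (C : Submodule F (Fin n → F)) (w t : ℕ) : Prop :=
  ∀ T T' : Finset (Fin n), #T = t → #T' = t → cnt C w T = cnt C w T'

lemma card_supp {F : Type*} [Field F] (x : Fin n → F) : #(supp x) = hammingNorm x := by
  simp only [supp, hammingNorm]

lemma card_filter_supportDesign (C : Submodule F (Fin n → F)) (w : ℕ) (T : Finset (Fin n))
    {_ : DecidablePred fun b => T ⊆ b} :
    ((supportDesign C w).filter (fun b => T ⊆ b)).card = cnt C w T := by
  rw [supportDesign, Multiset.filter_map, Multiset.card_map, cnt, ← Finset.filter_val,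
    Finset.filter_filter, Finset.card_def]
  simp only [Function.comp_apply, and_assoc]
  congr!

lemma count_supportDesign (C : Submodule F (Fin n → F)) (w : ℕ) (S : Finset (Fin n))
    {_ : DecidableEq (Finset (Fin n))} :
    (supportDesign C w).count S
      = #{x : Fin n → F | x ∈ C ∧ hammingNorm x = w ∧ supp x = S} := by
  rw [supportDesign, Multiset.count_map, ← Finset.filter_val,
    Finset.filter_filter, Finset.card_def]
  congr 1
  ext x
  simp [and_assoc, eq_comm]

lemma cnt_pos {C : Submodule F (Fin n → F)} {x : Fin n → F} (hx : x ∈ C)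
    {T : Finset (Fin n)} (hT : T ⊆ supp x) : 0 < cnt C (hammingNorm x) T :=
  Finset.card_pos.2 ⟨x, by simp [hx, hT]⟩

lemma isTDesign_of_regular {C : Submodule F (Fin n → F)} {w t : ℕ} (htw : t ≤ w)
    (hw : ∃ x ∈ C, hammingNorm x = w) (h : Regular C w t) :
    IsTDesign t w (supportDesign C w) := by
  obtain ⟨x, hx, rfl⟩ := hw
  refine ⟨htw, ?_, ?_⟩
  · intro b hb
    simp only [supportDesign, Multiset.mem_map] at hb
    obtain ⟨y, hy, rfl⟩ := hb
    simp only [Finset.mem_val, mem_filter] at hy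
    rw [card_supp, hy.2.2]
  · obtain ⟨T, hT, hTc⟩ := Finset.exists_subset_card_eq (htw.trans (card_supp x).ge)
    refine ⟨_, cnt_pos hx hT, fun T' hT' => ?_⟩
    exact (@card_filter_supportDesign _ _ _ _ C _ T' _).trans (h _ _ hT' hTc)

lemma IsTDesign.regular {C : Submodule F (Fin n → F)} {w t : ℕ}
    (h : IsTDesign t w (supportDesign C w)) : Regular C w t := by
  obtain ⟨-, -, l, -, h⟩ := h
  intro T T' hT hT'
  have key : ∀ T : Finset (Fin n), #T = t → cnt C w T = l := fun T hT =>
    (@card_filter_supportDesign _ _ _ _ C w T _).symm.trans (h T hT)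
  rw [key T hT, key T' hT']

/-- Double counting of pairs (point outside `T`, codeword through both). -/
lemma sum_cnt_insert (C : Submodule F (Fin n → F)) (w : ℕ) (T : Finset (Fin n)) :
    ∑ i ∈ Tᶜ, cnt C w (insert i T) = (w - #T) * cnt C w T := by
  have h1 : ∀ i ∈ Tᶜ, cnt C w (insert i T)
      = ∑ x : Fin n → F, if (x ∈ C ∧ hammingNorm x = w ∧ T ⊆ supp x) ∧ i ∈ supp x then 1 else 0 := by
    intro i _
    rw [cnt, Finset.card_filter]
    refine Finset.sum_congr rfl fun x _ => ?_
    congr 1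
    rw [Finset.insert_subset_iff]
    simp only [eq_iff_iff]; tauto
  rw [Finset.sum_congr rfl h1, Finset.sum_comm, cnt, Finset.card_filter, Finset.mul_sum]
  refine Finset.sum_congr rfl fun x _ => ?_
  by_cases h : x ∈ C ∧ hammingNorm x = w ∧ T ⊆ supp x
  · simp only [h, true_and, if_true, and_self, mul_one]
    rw [← Finset.card_filter, ← h.2.1, ← card_supp, ← Finset.card_sdiff_of_subset h.2.2]
    congr 1
    ext i
    simp [and_comm]
  · simp [h]

/-- Summing over the points that extend a t-set counts each codeword through it w - t times, and
this factor is nonzero because t + 1 ≤ w. -/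
lemma Regular.pred {C : Submodule F (Fin n → F)} {w t : ℕ} (h : Regular C w (t + 1))
    (htw : t + 1 ≤ w) : Regular C w t := by
  have key : ∀ T T' : Finset (Fin n), #T = t → #T' = t →
      ∑ i ∈ Tᶜ, cnt C w (insert i T) = ∑ i ∈ T'ᶜ, cnt C w (insert i T') := by
    intro T T' hT hT'
    have hc : #(Tᶜ) = #(T'ᶜ) := by rw [card_compl, card_compl, hT, hT']
    obtain ⟨e⟩ : Nonempty ({i // i ∈ Tᶜ} ≃ {i // i ∈ T'ᶜ}) := ⟨Finset.equivOfCardEq hc⟩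
    rw [← Finset.sum_coe_sort, ← Finset.sum_coe_sort (T'ᶜ)]
    refine Fintype.sum_equiv e _ _ fun i => ?_
    refine h _ _ ?_ ?_
    · rw [card_insert_of_notMem (mem_compl.1 i.2), hT]
    · rw [card_insert_of_notMem (mem_compl.1 (e i).2), hT']
  intro T T' hT hT'
  have := key T T' hT hT'
  rw [sum_cnt_insert, sum_cnt_insert, hT, hT'] at this
  exact Nat.eq_of_mul_eq_mul_left (by omega) this

lemma Regular.mono {C : Submodule F (Fin n → F)} {w t s : ℕ} (h : Regular C w t)
    (hst : s ≤ t) (htw : t ≤ w) : Regular C w s := by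
  induction t with
  | zero => rwa [Nat.le_zero.1 hst]
  | succ k ih =>
    rcases Nat.lt_or_ge s (k + 1) with hs | hs
    · exact ih (h.pred htw) (by omega) (by omega)
    · rwa [le_antisymm hst hs]

/-- In a regular family the common value is determined by the number of codewords. -/
lemma sum_cnt_powersetCard (C : Submodule F (Fin n → F)) (w t : ℕ) :
    ∑ T ∈ (univ : Finset (Fin n)).powersetCard t, cnt C w T = w.choose t * cnt C w ∅ := by
  simp only [cnt, Finset.card_filter, empty_subset, and_true]
  rw [Finset.sum_comm, Finset.mul_sum]
  refine Finset.sum_congr rfl fun x _ => ?_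
  by_cases h : x ∈ C ∧ hammingNorm x = w
  · simp only [h, true_and, if_true, and_self, mul_one]
    rw [← Finset.card_filter, ← h.2, ← card_supp, ← Finset.card_powersetCard]
    congr 1
    ext T
    simp [mem_powersetCard, and_comm]
  · rw [if_neg h, mul_zero]
    refine Finset.sum_eq_zero fun T _ => if_neg fun h' => h ⟨h'.1, h'.2.1⟩

lemma Regular.choose_mul {C : Submodule F (Fin n → F)} {w t : ℕ} (h : Regular C w t)
    {T : Finset (Fin n)} (hT : #T = t) :
    n.choose t * cnt C w T = w.choose t * cnt C w ∅ := by
  rw [← sum_cnt_powersetCard, Finset.sum_congr rfl (fun U hU => h U T (mem_powersetCard.1 hU).2 hT),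
    Finset.sum_const, Finset.card_powersetCard, Finset.card_univ, Fintype.card_fin, smul_eq_mul]

lemma cnt_eq_count (C : Submodule F (Fin n → F)) {w : ℕ} {S : Finset (Fin n)} (hS : #S = w)
    {_ : DecidableEq (Finset (Fin n))} : cnt C w S = (supportDesign C w).count S := by
  rw [count_supportDesign, cnt]
  congr 1
  ext x
  simp only [mem_filter, mem_univ, true_and]
  refine and_congr_right fun _ => and_congr_right fun hx => ⟨fun h => ?_, fun h => h.ge⟩
  exact (Finset.eq_of_subset_of_card_le h (by rw [card_supp, hx, hS])).symm

lemma regular_of_isTrivialDesign {C : Submodule F (Fin n → F)} {w t : ℕ} (htw : t ≤ w)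
    (h : IsTrivialDesign w (supportDesign C w)) : Regular C w t := by
  refine Regular.mono (t := w) ?_ htw le_rfl
  obtain ⟨mu, h⟩ := h
  intro T T' hT hT'
  exact (@cnt_eq_count _ _ _ _ C w T hT _).trans
    ((h T hT).trans ((h T' hT').symm.trans (@cnt_eq_count _ _ _ _ C w T' hT' _).symm))

/-- Inclusion-exclusion for the codewords vanishing on `U`. -/
lemma card_disjoint_supp (C : Submodule F (Fin n → F)) (w : ℕ) (U : Finset (Fin n)) :
    (#{x : Fin n → F | x ∈ C ∧ hammingNorm x = w ∧ Disjoint U (supp x)} : ℤ)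
      = ∑ V ∈ U.powerset, (-1) ^ #V * (cnt C w V : ℤ) := by
  simp only [cnt, Finset.card_filter, Nat.cast_sum, Finset.mul_sum]
  rw [Finset.sum_comm]
  refine Finset.sum_congr rfl fun x _ => ?_
  by_cases h : x ∈ C ∧ hammingNorm x = w
  · have h1 : (∑ V ∈ U.powerset, (-1 : ℤ) ^ #V * ((if V ⊆ supp x then 1 else 0 : ℕ) : ℤ))
        = ∑ V ∈ (U ∩ supp x).powerset, (-1 : ℤ) ^ #V := by
      rw [show (U ∩ supp x).powerset = {V ∈ U.powerset | V ⊆ supp x} by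
        ext V; rw [mem_powerset, Finset.subset_inter_iff]; simp, Finset.sum_filter]
      refine Finset.sum_congr rfl fun V _ => ?_
      simp
    simp only [h, true_and]
    rw [h1, Finset.sum_powerset_neg_one_pow_card]
    simp only [Finset.disjoint_iff_inter_eq_empty, Nat.cast_ite, Nat.cast_one, Nat.cast_zero]
  · have : ∀ p : Prop, ¬ (x ∈ C ∧ hammingNorm x = w ∧ p) := fun p hp => h ⟨hp.1, hp.2.1⟩
    simp [this]

/-- A function on subsets that only depends on the cardinality has a powerset sum that only
depends on the cardinality. -/
lemma sum_powerset_congr {ι R : Type*} [CommRing R] {T T' : Finset ι}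
    (hT : #T = #T') (f f' : Finset ι → R)
    (h : ∀ U ⊆ T, ∀ U' ⊆ T', #U = #U' → f U = f' U') :
    ∑ U ∈ T.powerset, f U = ∑ U ∈ T'.powerset, f' U := by
  rw [Finset.sum_powerset, Finset.sum_powerset, hT]
  refine Finset.sum_congr rfl fun j hj => ?_
  have hc : #(T.powersetCard j) = #(T'.powersetCard j) := by simp [hT]
  rw [← Finset.sum_coe_sort, ← Finset.sum_coe_sort (T'.powersetCard j)]
  refine Fintype.sum_equiv (Finset.equivOfCardEq hc) _ _ fun i => ?_
  have h1 := mem_powersetCard.1 i.2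
  have h2 := mem_powersetCard.1 (Finset.equivOfCardEq hc i).2
  exact h _ h1.1 _ h2.1 (h1.2.trans h2.2.symm)

/-- A word of weight w has support S exactly when it vanishes off S. Inclusion-exclusion over the
complement, which has at most v points, uses only counts that depend on cardinality. -/
lemma isTrivialDesign_of_regular {C : Submodule F (Fin n → F)} {w v : ℕ} (hw : n - w ≤ v)
    (h : ∀ j ≤ v, Regular C w j) : IsTrivialDesign w (supportDesign C w) := by
  have key : ∀ S S' : Finset (Fin n), #S = w → #S' = w →
      (supportDesign C w).count S = (supportDesign C w).count S' := by
    have h1 : ∀ S : Finset (Fin n), #S = w → ((supportDesign C w).count S : ℤ)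
        = ∑ V ∈ (Sᶜ).powerset, (-1) ^ #V * (cnt C w V : ℤ) := by
      intro S hS
      rw [← card_disjoint_supp, ← cnt_eq_count C hS, cnt]
      congr 2
      ext x
      simp only [mem_filter, mem_univ, true_and]
      refine and_congr_right fun _ => and_congr_right fun hx => ?_
      rw [Finset.disjoint_left]
      simp only [mem_compl, not_imp_not]
      change S ⊆ supp x ↔ supp x ⊆ S
      exact ⟨fun h => (Finset.eq_of_subset_of_card_le h (by rw [card_supp, hx, hS])).ge,
        fun h => (Finset.eq_of_subset_of_card_le h (by rw [card_supp, hx, hS])).ge⟩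
    intro S S' hS hS'
    have : ((supportDesign C w).count S : ℤ) = (supportDesign C w).count S' := by
      rw [h1 S hS, h1 S' hS']
      refine sum_powerset_congr (by rw [card_compl, card_compl, hS, hS']) _ _ fun U hU U' _ hc => ?_
      have : #U ≤ v := (card_le_card hU).trans (by rw [card_compl, hS, Fintype.card_fin]; exact hw)
      rw [hc, h _ this U U' rfl hc.symm]
    exact_mod_cast this
  by_cases hn : ∃ S : Finset (Fin n), #S = w
  · obtain ⟨S, hS⟩ := hn
    refine ⟨(supportDesign C w).count S, fun S' hS' => ?_⟩
    convert key S' S hS' hS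
  · exact ⟨0, fun S hS => absurd ⟨S, hS⟩ hn⟩

/-- The minimum weight bounds δ from above and realizes s from below. For the upper bound on s, a
weight with more than n - v - 1 nonzero entries gives a trivial design, and for every other weight
`hback` carries a (v + 1)-design back to weight d. -/
theorem deltaSEq_of_regular {C : Submodule F (Fin n → F)} {d v : ℕ} (hd : 0 < d) (hvd : v + 1 ≤ d)
    (hmin : IsMinDist C d)
    (hreg : ∀ w, ∀ j ≤ v, Regular C w j)
    (hback : ∀ w, d ≤ w → v + 1 + w ≤ n → (∃ x ∈ C, hammingNorm x = w) →
      Regular C w (v + 1) → Regular C d (v + 1))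
    (hnot : ¬ Regular C d (v + 1)) : DeltaSEq C v := by
  obtain ⟨⟨x₀, hx₀, hx₀', hx₀d⟩, hlow⟩ := hmin
  have hge : ∀ w, 0 < w → (∃ x ∈ C, hammingNorm x = w) → d ≤ w := by
    rintro w hw ⟨x, hx, rfl⟩
    exact hlow ⟨x, hx, hammingNorm_pos_iff.1 hw, rfl⟩
  have hdtriv : ¬ IsTrivialDesign d (supportDesign C d) := fun h =>
    hnot (regular_of_isTrivialDesign hvd h)
  refine ⟨⟨?_, ?_⟩, ⟨?_, ?_⟩⟩
  · intro w hw hex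
    exact isTDesign_of_regular (by have := hge w hw hex; omega) hex (hreg w v le_rfl)
  · intro t ht
    by_contra hlt
    have h := ht d hd ⟨x₀, hx₀, hx₀d⟩
    exact hnot (h.regular.mono (by omega) h.1)
  · exact ⟨d, hd, hdtriv, isTDesign_of_regular (by omega) ⟨x₀, hx₀, hx₀d⟩ (hreg d v le_rfl)⟩
  · rintro t ⟨w, hw, hnt, ht⟩
    by_contra hlt
    have hr : Regular C w (v + 1) := ht.regular.mono (by omega) ht.1
    -- A weight that does not occur gives the empty design, which is trivial with multiplicity 0.
    have hex : ∃ x ∈ C, hammingNorm x = w := by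
      by_contra hne
      refine hnt ⟨0, fun S hS => ?_⟩
      refine (@cnt_eq_count _ _ _ _ C w S hS _).symm.trans ?_
      refine Finset.card_eq_zero.2 (Finset.eq_empty_of_forall_notMem fun x hx => hne ⟨x, ?_⟩)
      exact ⟨(mem_filter.1 hx).2.1, (mem_filter.1 hx).2.2.1⟩
    have hle := hge w hw hex
    by_cases hwn : v + 1 + w ≤ n
    · exact hnot (hback w hle hwn hex hr)
    · exact hnt (isTrivialDesign_of_regular (v := v) (by omega) fun j hj => hreg w j hj)

end

/-! ### The trace character of the field of four elements and the MacWilliams identity. -/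

section

section Character
variable {F : Type*} [Field F] [Fintype F]

lemma two_eq_zero (hF : Fintype.card F = 4) : (2 : F) = 0 := by
  have h : ((Fintype.card F : ℕ) : F) = 0 := Nat.cast_card_eq_zero F
  rw [hF] at h
  have h2 : (2 : F) * 2 = 0 := by rw [← h]; norm_num
  simpa using h2

lemma pow_four (hF : Fintype.card F = 4) (u : F) : u ^ 4 = u := by
  rw [← hF]; exact FiniteField.pow_card u

/-- The nontrivial additive character `u ↦ (-1) ^ Tr u` of the field of four elements. -/
def traceChar (hF : Fintype.card F = 4) : AddChar F ℚ where
  toFun u := if u ^ 2 = u then 1 else -1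
  map_zero_eq_one' := by simp
  map_add_eq_mul' u v := by
    have h2 := two_eq_zero hF
    have key : ∀ w : F, w ^ 2 = w ∨ w ^ 2 = w + 1 := by
      intro w
      have h4 := pow_four hF w
      have : (w ^ 2 - w) * (w ^ 2 - (w + 1)) = 0 := by
        linear_combination h4 - (w ^ 3 - w) * h2
      rcases mul_eq_zero.1 this with h | h
      · exact Or.inl (sub_eq_zero.1 h)
      · exact Or.inr (sub_eq_zero.1 h)
    have hadd : (u + v) ^ 2 = u ^ 2 + v ^ 2 := by linear_combination u * v * h2
    rcases key u with hu | hu <;> rcases key v with hv | hv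
    · simp [hadd, hu, hv]
    · simp [hadd, hu, hv]
    · have h' : u + 1 + v ≠ u + v := fun h => one_ne_zero (α := F) (by linear_combination h)
      simp [hadd, hu, hv, h']
    · have h' : u + 1 + (v + 1) = u + v := by linear_combination h2
      simp [hadd, hu, hv, h']

lemma _root_.AddChar.map_finset_sum_eq_prod {A M ι : Type*} [AddCommMonoid A] [CommMonoid M]
    (ψ : AddChar A M) (s : Finset ι) (f : ι → A) : ψ (∑ i ∈ s, f i) = ∏ i ∈ s, ψ (f i) := by
  induction s using Finset.induction_on with
  | empty => simp
  | insert i s hi ih => rw [sum_insert hi, prod_insert hi, AddChar.map_add_eq_mul, ih]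

lemma exists_traceChar (hF : Fintype.card F = 4) : ∃ u : F, traceChar hF u = -1 := by
  obtain ⟨u, hu⟩ : ∃ u : F, u ∉ ({0, 1} : Finset F) := by
    by_contra! h
    have h1 : (univ : Finset F) ⊆ {0, 1} := fun u _ => h u
    have h2 := (card_le_card h1).trans Finset.card_le_two
    rw [Finset.card_univ, hF] at h2
    omega
  refine ⟨u, ?_⟩
  have : u ^ 2 ≠ u := by
    intro h
    have h' : u * (u - 1) = 0 := by linear_combination h
    rcases mul_eq_zero.1 h' with h | h
    · simp [h] at hu
    · simp [sub_eq_zero.1 h] at hu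
  simp [traceChar, this]

lemma sum_traceChar (hF : Fintype.card F = 4) : ∑ u : F, traceChar hF u = 0 := by
  obtain ⟨u, hu⟩ := exists_traceChar hF
  refine AddChar.sum_eq_zero_of_ne_one fun h => ?_
  rw [h] at hu
  norm_num at hu

lemma sum_traceChar_mul_sq (hF : Fintype.card F = 4) (u : F) :
    ∑ v : F, traceChar hF (u * v ^ 2) = if u = 0 then 4 else 0 := by
  split_ifs with h
  · simp [h, hF]
  · rw [← sum_traceChar hF]
    have hinj : Function.Injective fun v : F => u * v ^ 2 := by
      intro v w hvw
      have h1 : v ^ 2 = w ^ 2 := mul_left_cancel₀ h hvw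
      have h2 := two_eq_zero hF
      have h3 : (v - w) ^ 2 = 0 := by linear_combination h1 + (w ^ 2 - v * w) * h2
      exact sub_eq_zero.1 (pow_eq_zero_iff two_ne_zero |>.1 h3)
    exact Fintype.sum_bijective _ (Finite.injective_iff_bijective.1 hinj) _ _ fun _ => rfl

end Character

variable {F : Type*} [Field F] [Fintype F] {n : ℕ}

/-- Orthogonality of characters: for v outside the code, some codeword has inner product with v of
character value -1, and translating by it negates the sum. -/
lemma sum_traceChar_hermitianInner (hF : Fintype.card F = 4) {C : Submodule F (Fin n → F)}
    (hC : (C : Set (Fin n → F)) = hermitianDual C) (v : Fin n → F) :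
    ∑ x : Fin n → F with x ∈ C, traceChar hF (hermitianInner x v)
      = if v ∈ C then (#{x : Fin n → F | x ∈ C} : ℚ) else 0 := by
  have hmem : v ∈ C ↔ ∀ x ∈ C, hermitianInner x v = 0 := by
    rw [← SetLike.mem_coe, hC]; rfl
  have hadd : ∀ x y : Fin n → F,
      hermitianInner (x + y) v = hermitianInner x v + hermitianInner y v := by
    intro x y
    simp [hermitianInner, add_mul, Finset.sum_add_distrib]
  split_ifs with hv
  · rw [Finset.sum_congr rfl (g := fun _ => (1 : ℚ))]
    · simp
    · intro x hx
      rw [hmem.1 hv x (mem_filter.1 hx).2, AddChar.map_zero_eq_one]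
  · rw [hmem] at hv
    push Not at hv
    obtain ⟨x₀, hx₀, hne⟩ := hv
    obtain ⟨u, hu⟩ := exists_traceChar hF
    set x₁ := (u / hermitianInner x₀ v) • x₀ with hx₁
    have h1 : hermitianInner x₁ v = u := by
      have : hermitianInner x₁ v = (u / hermitianInner x₀ v) * hermitianInner x₀ v := by
        simp only [hx₁, hermitianInner, Finset.mul_sum, Pi.smul_apply, smul_eq_mul, mul_assoc]
      rw [this, div_mul_cancel₀ _ hne]
    have hx₁C : x₁ ∈ C := C.smul_mem _ hx₀
    have h2 : ∑ x : Fin n → F with x ∈ C, traceChar hF (hermitianInner x v)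
        = ∑ x : Fin n → F with x ∈ C, traceChar hF (hermitianInner (x + x₁) v) := by
      refine (Finset.sum_equiv (Equiv.addRight x₁) ?_ ?_).symm
      · intro x
        simp [C.add_mem_iff_left hx₁C]
      · intro x _; rfl
    simp only [hadd, h1, AddChar.map_add_eq_mul, hu, mul_neg, mul_one, Finset.sum_neg_distrib] at h2
    linarith

/-- The MacWilliams identity for Hermitian self-dual codes and product weights, up to the size
of the code. -/
lemma macWilliams_aux (hF : Fintype.card F = 4) {C : Submodule F (Fin n → F)}
    (hC : (C : Set (Fin n → F)) = hermitianDual C) (g₀ g₁ : Fin n → ℚ) :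
    ∑ x : Fin n → F with x ∈ C, ∏ i, (if x i = 0 then g₀ i + 3 * g₁ i else g₀ i - g₁ i)
      = (#{x : Fin n → F | x ∈ C} : ℚ) *
        ∑ x : Fin n → F with x ∈ C, ∏ i, (if x i = 0 then g₀ i else g₁ i) := by
  -- The transformed weight at one coordinate is a character sum; multiplying over the coordinates
  -- produces the character of the inner product.
  have h1 : ∀ (i : Fin n) (u : F), (if u = 0 then g₀ i + 3 * g₁ i else g₀ i - g₁ i)
      = ∑ v : F, traceChar hF (u * v ^ 2) * (if v = 0 then g₀ i else g₁ i) := by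
    intro i u
    have : ∀ v : F, traceChar hF (u * v ^ 2) * (if v = 0 then g₀ i else g₁ i)
        = g₁ i * traceChar hF (u * v ^ 2) + if v = 0 then g₀ i - g₁ i else 0 := by
      intro v
      split_ifs with hv
      · simp [hv]
      · ring
    simp_rw [this]
    rw [Finset.sum_add_distrib, ← Finset.mul_sum, sum_traceChar_mul_sq]
    simp only [Finset.sum_ite_eq', mem_univ, if_true]
    split_ifs <;> ring
  simp_rw [h1]
  have h2 : ∀ x : Fin n → F,
      ∏ i, ∑ v : F, traceChar hF (x i * v ^ 2) * (if v = 0 then g₀ i else g₁ i)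
      = ∑ v : Fin n → F, traceChar hF (hermitianInner x v) *
          ∏ i, (if v i = 0 then g₀ i else g₁ i) := by
    intro x
    rw [Finset.prod_univ_sum, Fintype.piFinset_univ]
    refine Finset.sum_congr rfl fun v _ => ?_
    rw [Finset.prod_mul_distrib, hermitianInner, AddChar.map_finset_sum_eq_prod]
  simp_rw [h2]
  rw [Finset.sum_comm]
  simp_rw [← Finset.sum_mul, sum_traceChar_hermitianInner hF hC]
  rw [Finset.mul_sum, Finset.sum_filter]
  refine Finset.sum_congr rfl fun v _ => ?_
  split_ifs <;> simp

/-- With constant weights 1 only the zero word survives on the transformed side, with value 4^n, and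
the other side is the square of the size of the code. -/
lemma card_code (hF : Fintype.card F = 4) {C : Submodule F (Fin n → F)}
    (hC : (C : Set (Fin n → F)) = hermitianDual C) :
    (#{x : Fin n → F | x ∈ C} : ℚ) = 2 ^ n := by
  have h := macWilliams_aux hF hC 1 1
  have h1 : ∀ x : Fin n → F, ∏ i, (if x i = 0 then (1 : Fin n → ℚ) i + 3 * (1 : Fin n → ℚ) i
      else (1 : Fin n → ℚ) i - (1 : Fin n → ℚ) i) = if x = 0 then 4 ^ n else 0 := by
    intro x
    split_ifs with hx
    · subst hx
      simp
      norm_num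
    · obtain ⟨i, hi⟩ := Function.ne_iff.1 hx
      refine Finset.prod_eq_zero (mem_univ i) ?_
      simp only [Pi.zero_apply] at hi
      simp [hi]
  simp_rw [h1] at h
  simp only [Pi.one_apply, ite_self, prod_const_one, sum_const, nsmul_eq_mul, mul_one] at h
  rw [Finset.sum_ite_eq' , if_pos (by simp)] at h
  have h4 : (4 : ℚ) ^ n = (2 ^ n) ^ 2 := by rw [← pow_mul, mul_comm, pow_mul]; norm_num
  rw [h4, ← sq] at h
  exact ((pow_left_inj₀ (by positivity) (by positivity) two_ne_zero).1 h).symm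

/-- The MacWilliams identity for Hermitian self-dual codes and product weights. -/
theorem macWilliams (hF : Fintype.card F = 4) {C : Submodule F (Fin n → F)}
    (hC : (C : Set (Fin n → F)) = hermitianDual C) (g₀ g₁ : Fin n → ℚ) :
    ∑ x : Fin n → F with x ∈ C, ∏ i, (if x i = 0 then g₀ i + 3 * g₁ i else g₀ i - g₁ i)
      = 2 ^ n * ∑ x : Fin n → F with x ∈ C, ∏ i, (if x i = 0 then g₀ i else g₁ i) := by
  rw [macWilliams_aux hF hC, card_code hF hC]

end

/-! ### Enumerators of codewords through a set of coordinates. -/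

section

variable {F : Type*} [Field F] [Fintype F] {n : ℕ}

/-- The weight enumerator of the codewords whose support contains `T`. -/
def enum (C : Submodule F (Fin n → F)) (T : Finset (Fin n)) (A B : ℚ) : ℚ :=
  ∑ x : Fin n → F with x ∈ C, ∏ i, (if x i = 0 then (if i ∈ T then 0 else A) else B)

lemma prod_ite_zero_eq {F : Type*} [Field F] (x : Fin n → F) (A B : ℚ) :
    ∏ i, (if x i = 0 then A else B) = A ^ (n - hammingNorm x) * B ^ hammingNorm x := by
  rw [Finset.prod_ite, prod_const, prod_const]
  have h1 : #{i | ¬ x i = 0} = hammingNorm x := by simp [hammingNorm]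
  have h2 := Finset.card_filter_add_card_filter_not (s := (univ : Finset (Fin n)))
    (fun i => x i = 0)
  rw [h1, card_univ, Fintype.card_fin] at h2
  rw [h1]
  congr 2
  omega

lemma prod_ite_subset {F : Type*} [Field F] (x : Fin n → F) (U : Finset (Fin n)) (b : ℚ) :
    ∏ i ∈ U, (if x i = 0 then 0 else b) = if U ⊆ supp x then b ^ #U else 0 := by
  split_ifs with h
  · rw [← prod_const]
    refine Finset.prod_congr rfl fun i hi => if_neg ?_
    have := h hi
    simpa [supp] using this
  · obtain ⟨i, hi, hi'⟩ := Finset.not_subset.1 h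
    refine Finset.prod_eq_zero hi (if_pos ?_)
    simpa [supp] using hi'

lemma enum_summand {F : Type*} [Field F] (x : Fin n → F) (T : Finset (Fin n)) (A B : ℚ) :
    ∏ i, (if x i = 0 then (if i ∈ T then 0 else A) else B)
      = if T ⊆ supp x then A ^ (n - hammingNorm x) * B ^ hammingNorm x else 0 := by
  split_ifs with h
  · rw [← prod_ite_zero_eq]
    refine Finset.prod_congr rfl fun i _ => ?_
    split_ifs with h0 h1
    · have := h h1
      simp [supp, h0] at this
    · rfl
    · rfl
  · obtain ⟨i, hi, hi'⟩ := Finset.not_subset.1 h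
    refine Finset.prod_eq_zero (mem_univ i) ?_
    have : x i = 0 := by simpa [supp] using hi'
    simp [this, hi]

lemma hammingNorm_le {F : Type*} [Field F] (x : Fin n → F) : hammingNorm x ≤ n := by
  simpa using hammingNorm_le_card_fintype (x := x)

lemma enum_eq_sum (C : Submodule F (Fin n → F)) (T : Finset (Fin n)) (A B : ℚ) :
    enum C T A B = ∑ w ∈ range (n + 1), (cnt C w T : ℚ) * (A ^ (n - w) * B ^ w) := by
  simp only [enum, enum_summand, cnt, Finset.card_filter, Nat.cast_sum, Finset.sum_mul]
  rw [Finset.sum_comm, Finset.sum_filter]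
  refine Finset.sum_congr rfl fun x _ => ?_
  rw [Finset.sum_eq_single (hammingNorm x)]
  · by_cases h1 : x ∈ C <;> by_cases h2 : T ⊆ supp x <;> simp [h1, h2]
  · intro w _ hw
    rw [if_neg fun h => hw h.2.1.symm]
    simp
  · intro h
    exact absurd (mem_range.2 (Nat.lt_succ_of_le (hammingNorm_le x))) h

lemma enum_transform (hF : Fintype.card F = 4) {C : Submodule F (Fin n → F)}
    (hC : (C : Set (Fin n → F)) = hermitianDual C) (T : Finset (Fin n)) (A B : ℚ)
    (hA : A + 3 * B ≠ 0) (hB : A - B ≠ 0) :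
    2 ^ n * enum C T A B = ∑ U ∈ T.powerset,
      (-(4 * A * B) / ((A + 3 * B) * (A - B))) ^ #U * (3 * B / (A + 3 * B)) ^ (#T - #U) *
        enum C U (A + 3 * B) (A - B) := by
  rw [enum, ← macWilliams hF hC]
  simp only [enum, Finset.mul_sum]
  rw [Finset.sum_comm]
  refine Finset.sum_congr rfl fun x _ => ?_
  -- At a point of T the transformed values are 3B and -B instead of A + 3B and A - B. Their ratio
  -- to the latter is a constant plus a term present only where x is nonzero, and expanding the
  -- product over T gives the sum over subsets.
  have h1 : ∏ i, (if x i = 0 then (if i ∈ T then 0 else A) + 3 * B else (if i ∈ T then 0 else A) - B)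
      = (∏ i, if x i = 0 then A + 3 * B else A - B) *
        ∏ i ∈ T, ((if x i = 0 then 0 else -(4 * A * B) / ((A + 3 * B) * (A - B)))
          + 3 * B / (A + 3 * B)) := by
    rw [← Finset.prod_ite_mem_eq T, ← Finset.prod_mul_distrib]
    refine Finset.prod_congr rfl fun i _ => ?_
    by_cases h0 : x i = 0 <;> by_cases h1 : i ∈ T <;> simp only [h0, h1, if_true, if_false]
    · rw [zero_add, zero_add, mul_div_cancel₀ _ hA]
    · ring
    · rw [div_add_div _ _ (mul_ne_zero hA hB) hA, mul_div_assoc',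
        eq_div_iff (mul_ne_zero (mul_ne_zero hA hB) hA)]
      ring
    · ring
  rw [h1, Finset.prod_add, Finset.mul_sum]
  refine Finset.sum_congr rfl fun U hU => ?_
  rw [enum_summand, prod_ite_zero_eq, prod_ite_subset, prod_const,
    card_sdiff_of_subset (mem_powerset.1 hU)]
  split_ifs <;> ring

lemma sum_powerset_sub_congr {ι R : Type*} [CommRing R] {T T' : Finset ι}
    (hT : #T = #T') (f f' : Finset ι → R)
    (h : ∀ U ⊆ T, ∀ U' ⊆ T', #U < #T → #U = #U' → f U = f' U') :
    ∑ U ∈ T.powerset, f U - ∑ U ∈ T'.powerset, f' U = f T - f' T' := by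
  have h1 : ∀ (S : Finset ι) (g : Finset ι → R), ∑ U ∈ S.powerset, g U
      = g S + ∑ U ∈ S.powerset, if #U < #S then g U else 0 := by
    intro S g
    rw [← sub_eq_iff_eq_add, ← Finset.sum_sub_distrib,
      Finset.sum_eq_single_of_mem S (mem_powerset_self S)]
    · simp
    · intro U hU hne
      have : #U < #S := card_lt_card ((mem_powerset.1 hU).ssubset_of_ne hne)
      simp [this]
  rw [h1 T, h1 T', sum_powerset_congr hT (fun U => if #U < #T then f U else 0)
    (fun U => if #U < #T' then f' U else 0)]
  · ring
  · intro U hU U' hU' hc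
    simp only [← hc, ← hT]
    split_ifs with hlt
    · exact h U hU U' hU' hlt hc
    · rfl

/-- Comparing two `t`-sets of coordinates when all smaller sets behave uniformly. -/
lemma enum_sub_transform (hF : Fintype.card F = 4) {C : Submodule F (Fin n → F)}
    (hC : (C : Set (Fin n → F)) = hermitianDual C) {T T' : Finset (Fin n)} (hT : #T = #T')
    (hreg : ∀ w, ∀ j < #T, Regular C w j) (A B : ℚ)
    (hA : A + 3 * B ≠ 0) (hB : A - B ≠ 0) :
    2 ^ n * (enum C T A B - enum C T' A B) = (-(4 * A * B) / ((A + 3 * B) * (A - B))) ^ #T *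
        (enum C T (A + 3 * B) (A - B) - enum C T' (A + 3 * B) (A - B)) := by
  have hU : ∀ U U' : Finset (Fin n), #U < #T → #U = #U' →
      enum C U (A + 3 * B) (A - B) = enum C U' (A + 3 * B) (A - B) := by
    intro U U' hU hc
    rw [enum_eq_sum, enum_eq_sum]
    refine Finset.sum_congr rfl fun w _ => ?_
    rw [hreg w _ hU U U' rfl hc.symm]
  rw [mul_sub, enum_transform hF hC T A B hA hB, enum_transform hF hC T' A B hA hB,
    sum_powerset_sub_congr hT]
  · rw [hT]
    simp only [Nat.sub_self, pow_zero, mul_one]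
    ring
  · intro U _ U' _ hlt hc
    rw [hU U U' hlt hc, hc, hT]

/-- The difference between the numbers of codewords of weight `w` through `T` and `T'`. -/
def cntDiff (C : Submodule F (Fin n → F)) (T T' : Finset (Fin n)) (w : ℕ) : ℚ :=
  (cnt C w T : ℚ) - cnt C w T'

lemma cntDiff_eq_zero_of_lt (C : Submodule F (Fin n → F)) {T T' : Finset (Fin n)}
    (hT : #T = #T') {w : ℕ} (hw : w < #T) : cntDiff C T T' w = 0 := by
  have h : ∀ U : Finset (Fin n), w < #U → cnt C w U = 0 := by
    intro U hU
    refine Finset.card_eq_zero.2 (Finset.eq_empty_of_forall_notMem fun x hx => ?_)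
    simp only [mem_filter, mem_univ, true_and] at hx
    have := card_le_card hx.2.2
    rw [card_supp, hx.2.1] at this
    omega
  rw [cntDiff, h T hw, h T' (hT ▸ hw), sub_self]

/-- A word of weight above n - t cannot avoid a t-set, so the inclusion-exclusion sums over T and
over T' are both zero. They differ only in their top terms. -/
lemma cntDiff_eq_zero_of_gt (C : Submodule F (Fin n → F)) {T T' : Finset (Fin n)}
    (hT : #T = #T') {w : ℕ} (hreg : ∀ j < #T, Regular C w j) (hw : n < w + #T) :
    cntDiff C T T' w = 0 := by
  have h0 : ∀ U : Finset (Fin n), #U = #T →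
      ∑ V ∈ U.powerset, (-1 : ℤ) ^ #V * (cnt C w V : ℤ) = 0 := by
    intro U hU
    rw [← card_disjoint_supp, Nat.cast_eq_zero]
    refine Finset.card_eq_zero.2 (Finset.eq_empty_of_forall_notMem fun x hx => ?_)
    simp only [mem_filter, mem_univ, true_and] at hx
    have := card_union_of_disjoint hx.2.2
    have h2 := card_le_univ (U ∪ supp x)
    rw [card_supp, hx.2.1] at this
    rw [Fintype.card_fin] at h2
    omega
  have h1 := sum_powerset_sub_congr hT (fun V => (-1 : ℤ) ^ #V * (cnt C w V : ℤ))
    (fun V => (-1 : ℤ) ^ #V * (cnt C w V : ℤ)) (by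
      intro U _ U' _ hlt hc
      rw [hreg _ hlt U U' rfl hc.symm, hc])
  rw [h0 T rfl, h0 T' hT.symm, hT, ← mul_sub, sub_self] at h1
  have h2 : (cnt C w T : ℤ) - cnt C w T' = 0 := by
    rcases mul_eq_zero.1 h1.symm with h | h
    · exact absurd h (pow_ne_zero _ (by norm_num))
    · exact h
  rw [cntDiff]
  exact_mod_cast h2

lemma cnt_eq_zero_of_odd {C : Submodule F (Fin n → F)} (hC : ∀ x ∈ C, 2 ∣ hammingNorm x)
    (T : Finset (Fin n)) {w : ℕ} (hw : ¬ 2 ∣ w) : cnt C w T = 0 := by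
  refine Finset.card_eq_zero.2 (Finset.eq_empty_of_forall_notMem fun x hx => ?_)
  simp only [mem_filter, mem_univ, true_and] at hx
  exact hw (hx.2.1 ▸ hC x hx.1)

lemma cnt_eq_zero_of_lt {C : Submodule F (Fin n → F)} {d : ℕ} (hmin : IsMinDist C d)
    (T : Finset (Fin n)) {w : ℕ} (hw : w < d) (hw0 : 0 < w) : cnt C w T = 0 := by
  refine Finset.card_eq_zero.2 (Finset.eq_empty_of_forall_notMem fun x hx => ?_)
  simp only [mem_filter, mem_univ, true_and] at hx
  have := hmin.2 ⟨x, hx.1, hammingNorm_pos_iff.1 (hx.2.1 ▸ hw0), hx.2.1⟩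
  omega

lemma cnt_zero (C : Submodule F (Fin n → F)) (T : Finset (Fin n)) :
    cnt C 0 T = if T = ∅ then 1 else 0 := by
  have h : ∀ x : Fin n → F, (x ∈ C ∧ hammingNorm x = 0 ∧ T ⊆ supp x) ↔ x = 0 ∧ T = ∅ := by
    intro x
    rw [hammingNorm_eq_zero]
    constructor
    · rintro ⟨-, rfl, h⟩
      refine ⟨rfl, Finset.subset_empty.1 (h.trans ?_)⟩
      simp [supp]
    · rintro ⟨rfl, rfl⟩
      exact ⟨C.zero_mem, rfl, Finset.empty_subset _⟩
  simp only [cnt, h]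
  split_ifs with hT
  · simp [hT, Finset.filter_eq']
  · simp [hT]

lemma cntDiff_zero (C : Submodule F (Fin n → F)) {T T' : Finset (Fin n)} (hT : #T = #T') :
    cntDiff C T T' 0 = 0 := by
  rw [cntDiff, cnt_zero, cnt_zero]
  simp only [← Finset.card_eq_zero, hT, sub_self]

end

/-! ### Relative invariants of the MacWilliams transformation in one variable. -/

section

section Mobius
open Polynomial Filter

/-- Invariance up to the sign `ε`, in degree `N`, under the MacWilliams transformation
`(x, y) ↦ ((x + 3y) / 2, (x - y) / 2)` after setting `x = 1`. -/
def MobiusInv (N : ℕ) (ε : ℚ) (p : ℚ[X]) : Prop :=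
  p.natDegree ≤ N ∧ ∀ᶠ y : ℚ in cofinite,
    (1 + 3 * y) ^ N * p.eval ((1 - y) / (1 + 3 * y)) = ε * 2 ^ N * p.eval y

lemma eventually_one_add_three_mul_ne : ∀ᶠ y : ℚ in cofinite, 1 + 3 * y ≠ 0 := by
  refine (Set.finite_singleton (-1 / 3 : ℚ)).subset fun y hy => ?_
  simp only [ne_eq, not_not, Set.mem_compl_iff, Set.mem_ofPred_eq] at hy
  rw [Set.mem_singleton_iff]
  linarith

lemma eq_of_eventually_eval_eq {p q : ℚ[X]} (h : ∀ᶠ y in cofinite, p.eval y = q.eval y) : p = q :=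
  Polynomial.eq_of_infinite_eval_eq p q (frequently_cofinite_iff_infinite.1 h.frequently)

lemma exists_transform (s : ℚ[X]) {K : ℕ} (hs : s.natDegree ≤ K) : ∃ q : ℚ[X], ∀ y : ℚ,
    1 + 3 * y ≠ 0 → q.eval y = (1 + 3 * y) ^ K * s.eval ((1 - y) / (1 + 3 * y)) := by
  refine ⟨∑ j ∈ range (K + 1), C (s.coeff j) * ((1 + 3 * X) ^ (K - j) * (1 - X) ^ j),
    fun y hy => ?_⟩
  rw [Polynomial.eval_eq_sum_range' (Nat.lt_succ_of_le hs), Polynomial.eval_finsetSum,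
    Finset.mul_sum]
  refine Finset.sum_congr rfl fun j hj => ?_
  have hj' : j ≤ K := Nat.lt_succ_iff.1 (mem_range.1 hj)
  simp only [eval_mul, eval_pow, eval_add, eval_sub, eval_one, eval_X, eval_C, eval_ofNat]
  rw [div_pow, ← Nat.sub_add_cancel hj', pow_add, Nat.add_sub_cancel]
  field_simp

lemma MobiusInv.eval_eq {N : ℕ} {ε : ℚ} {p : ℚ[X]} (h : MobiusInv N ε p) {y : ℚ}
    (hy : 1 + 3 * y ≠ 0) :
    (1 + 3 * y) ^ N * p.eval ((1 - y) / (1 + 3 * y)) = ε * 2 ^ N * p.eval y := by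
  obtain ⟨q, hq⟩ := exists_transform p h.1
  have : q = C (ε * 2 ^ N) * p := by
    refine eq_of_eventually_eval_eq ?_
    filter_upwards [h.2, eventually_one_add_three_mul_ne] with y hy hy'
    rw [hq y hy', hy, eval_mul, eval_C]
  rw [← hq y hy, this, eval_mul, eval_C]

/-- The transformation carries the linear form y to a multiple of x - y, so a zero at y = 0 is moved
to y = 1 with its multiplicity. -/
lemma MobiusInv.one_sub_X_pow_dvd {N e : ℕ} {ε : ℚ} {p : ℚ[X]} (h : MobiusInv N ε p) (hε : ε ≠ 0)
    (hp : X ^ e ∣ p) : (1 - X) ^ e ∣ p := by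
  by_cases h0 : p = 0
  · simp [h0]
  obtain ⟨s, rfl⟩ := hp
  have hdeg := h.1
  have hs0 : s ≠ 0 := right_ne_zero_of_mul h0
  rw [natDegree_mul (pow_ne_zero _ X_ne_zero) hs0, natDegree_X_pow] at hdeg
  obtain ⟨q, hq⟩ := exists_transform s (K := N - e) (by omega)
  have key : C (ε * 2 ^ N) * (X ^ e * s) = (1 - X) ^ e * q := by
    refine eq_of_eventually_eval_eq ?_
    filter_upwards [h.2, eventually_one_add_three_mul_ne] with y hy hy'
    rw [eval_mul, eval_C, ← hy, eval_mul, eval_mul, hq y hy']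
    simp only [eval_pow, eval_sub, eval_one, eval_X]
    obtain ⟨k, rfl⟩ := Nat.exists_eq_add_of_le (show e ≤ N by omega)
    rw [Nat.add_sub_cancel_left, pow_add, div_pow]
    field_simp
  have hu : IsUnit (C (ε * 2 ^ N) : ℚ[X]) := isUnit_C.2 (isUnit_iff_ne_zero.2 (by positivity))
  exact (hu.dvd_mul_left).1 (key ▸ dvd_mul_right _ _)

/-- The product of the linear forms in the orbit of `y`, at `x = 1`. -/
def orbitForm : ℚ[X] := X * (1 - X ^ 2)

lemma natDegree_orbitForm : orbitForm.natDegree = 3 := by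
  unfold orbitForm; compute_degree!

lemma orbitForm_ne_zero : orbitForm ≠ 0 := by
  intro h
  have := natDegree_orbitForm
  simp [h] at this

lemma orbitForm_comp_neg : orbitForm.comp (-X) = -orbitForm := by
  simp [orbitForm]

lemma orbitForm_eval {y : ℚ} (hy : 1 + 3 * y ≠ 0) :
    (1 + 3 * y) ^ 3 * orbitForm.eval ((1 - y) / (1 + 3 * y)) = 2 ^ 3 * orbitForm.eval y := by
  simp only [orbitForm, eval_mul, eval_X, eval_sub, eval_one, eval_pow]
  field_simp
  ring

/-- Invariance yields the factor 1 - X, parity reflects it to 1 + X, and the three linear factors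
are pairwise coprime. -/
lemma orbitForm_pow_dvd {N e : ℕ} {ε δ : ℚ} {p : ℚ[X]} (h : MobiusInv N ε p) (hε : ε ≠ 0)
    (hδ : δ ≠ 0) (hpar : p.comp (-X) = C δ * p) (hp : X ^ e ∣ p) : orbitForm ^ e ∣ p := by
  have h1 := h.one_sub_X_pow_dvd hε hp
  have h2 : (1 + X) ^ e ∣ p := by
    obtain ⟨s, hs⟩ := h1
    have hu : IsUnit (C δ : ℚ[X]) := isUnit_C.2 (isUnit_iff_ne_zero.2 hδ)
    refine (hu.dvd_mul_left).1 (hpar ▸ ⟨s.comp (-X), ?_⟩)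
    conv_lhs => rw [hs]
    simp
  have c1 : IsCoprime (X : ℚ[X]) (1 - X) := ⟨1, 1, by ring⟩
  have c2 : IsCoprime (X * (1 - X) : ℚ[X]) (1 + X) := by
    refine IsCoprime.mul_left ⟨-1, 1, by ring⟩ ⟨C (1 / 2), C (1 / 2), ?_⟩
    rw [← mul_add, show (1 - X + (1 + X) : ℚ[X]) = C 2 by simp only [map_ofNat]; ring, ← C_mul]
    norm_num
  have h3 := (c1.pow (m := e) (n := e)).mul_dvd hp h1
  rw [← mul_pow] at h3
  have h4 := (c2.pow (m := e) (n := e)).mul_dvd h3 h2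
  rw [← mul_pow] at h4
  rwa [orbitForm, show (1 - X ^ 2 : ℚ[X]) = (1 - X) * (1 + X) by ring, ← mul_assoc]

lemma MobiusInv.eq_zero {N e : ℕ} {ε δ : ℚ} {p : ℚ[X]} (h : MobiusInv N ε p) (hε : ε ≠ 0)
    (hδ : δ ≠ 0) (hpar : p.comp (-X) = C δ * p) (hp : X ^ e ∣ p) (hN : N < 3 * e) : p = 0 := by
  by_contra h0
  have h1 := natDegree_le_of_dvd (orbitForm_pow_dvd h hε hδ hpar hp) h0
  rw [natDegree_pow, natDegree_orbitForm] at h1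
  have := h.1
  omega

/-- Since `orbitForm` is itself invariant of degree 3 with sign +1 and is odd, dividing by its e-th
power keeps the sign ε and leaves an even polynomial. -/
lemma MobiusInv.exists_quotient {r e : ℕ} {ε : ℚ} {p : ℚ[X]} (h : MobiusInv (3 * e + r) ε p)
    (hε : ε ≠ 0) (hpar : p.comp (-X) = C ((-1) ^ e) * p) (hp : X ^ e ∣ p) :
    ∃ R : ℚ[X], p = orbitForm ^ e * R ∧ MobiusInv r ε R ∧ R.comp (-X) = R := by
  obtain ⟨R, rfl⟩ := orbitForm_pow_dvd h hε (by positivity) hpar hp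
  have hne : orbitForm ^ e ≠ 0 := pow_ne_zero _ orbitForm_ne_zero
  refine ⟨R, rfl, ⟨?_, ?_⟩, ?_⟩
  · by_cases hR : R = 0
    · simp [hR]
    have := h.1
    rw [natDegree_mul hne hR, natDegree_pow, natDegree_orbitForm] at this
    omega
  · have hroot : ∀ᶠ y : ℚ in cofinite, orbitForm.eval y ≠ 0 := by
      refine (orbitForm.roots.toFinset.finite_toSet).subset fun y hy => ?_
      simpa [orbitForm_ne_zero] using hy
    filter_upwards [h.2, eventually_one_add_three_mul_ne, hroot] with y hy hy' hr
    rw [eval_mul, eval_mul, eval_pow, eval_pow, pow_add, pow_mul] at hy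
    have h3 : ((1 + 3 * y) ^ 3) ^ e * orbitForm.eval ((1 - y) / (1 + 3 * y)) ^ e
        = (2 ^ 3) ^ e * orbitForm.eval y ^ e := by
      rw [← mul_pow, orbitForm_eval hy', mul_pow]
    have h4 : ((2 ^ 3) ^ e * orbitForm.eval y ^ e) * ((1 + 3 * y) ^ r * R.eval ((1 - y) / (1 + 3 * y)))
        = ((2 ^ 3) ^ e * orbitForm.eval y ^ e) * (ε * 2 ^ r * R.eval y) := by
      rw [← h3]
      rw [pow_add 2, pow_mul 2] at hy
      linear_combination hy + (ε * 2 ^ r * R.eval y) * (-h3)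
    exact mul_left_cancel₀ (by positivity) h4
  · rw [mul_comp, pow_comp, orbitForm_comp_neg, neg_pow, C_pow, C_neg, C_1, mul_assoc] at hpar
    exact mul_left_cancel₀ hne (mul_left_cancel₀ (pow_ne_zero _ (by simp)) hpar)

lemma comp_neg_X_coeff (p : ℚ[X]) (j : ℕ) : (p.comp (-X)).coeff j = (-1) ^ j * p.coeff j := by
  rw [show (-X : ℚ[X]) = C (-1) * X by simp, comp_C_mul_X_coeff, mul_comm]

lemma coeff_odd_eq_zero {R : ℚ[X]} (h : R.comp (-X) = R) {j : ℕ} (hj : Odd j) :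
    R.coeff j = 0 := by
  have h1 := congrArg (fun q => coeff q j) h
  simp only [comp_neg_X_coeff, hj.neg_one_pow] at h1
  linarith

/-- The quotient of a relative invariant of degree `3 e + r` by the `e`-th power of
`orbitForm`, in terms of `X ^ 2`. -/
def smallInvariant : ℕ → ℚ[X]
  | 0 => 1
  | 1 => 0
  | 2 => 1 + C 3 * X
  | 3 => 1 - C 9 * X
  | 4 => 1 + C 6 * X + C 9 * X ^ 2
  | _ => 0

lemma MobiusInv.eq_smallInvariant {r : ℕ} (hr : r ≤ 4) {R : ℚ[X]} (h : MobiusInv r ((-1) ^ r) R)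
    (hpar : R.comp (-X) = R) : ∃ c : ℚ, R = C c * expand ℚ 2 (smallInvariant r) := by
  have h1 := coeff_odd_eq_zero hpar (j := 1) (by decide)
  have h3 := coeff_odd_eq_zero hpar (j := 3) (by decide)
  have hz : ∀ k, r < k → R.coeff k = 0 := fun k hk => coeff_eq_zero_of_natDegree_lt (h.1.trans_lt hk)
  have hR : R = C (R.coeff 0) + C (R.coeff 2) * X ^ 2 + C (R.coeff 4) * X ^ 4 := by
    conv_lhs => rw [R.as_sum_range_C_mul_X_pow' (n := 5) (by have := h.1; omega)]
    simp [Finset.sum_range_succ, h1, h3]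
  set c := R.coeff 0
  set b := R.coeff 2
  set a := R.coeff 4
  -- An even polynomial of degree at most 4 has three unknown coefficients; the points 1 and 2,
  -- which are sent to 0 and -1/7, give enough equations to express all of them through the constant
  -- term. For r = 1 the equation forces the constant term to vanish.
  have e1 := h.eval_eq (y := 1) (by norm_num)
  have e2 := h.eval_eq (y := 2) (by norm_num)
  have ev : ∀ y, R.eval y = c + b * y ^ 2 + a * y ^ 4 := by
    intro y; rw [hR]; simp
  simp only [ev] at e1 e2
  refine ⟨c, ?_⟩
  interval_cases r
  · have hb : b = 0 := hz 2 (by norm_num)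
    have ha : a = 0 := hz 4 (by norm_num)
    rw [hR, ha, hb]; simp [smallInvariant]
  · have hb : b = 0 := hz 2 (by norm_num)
    have ha : a = 0 := hz 4 (by norm_num)
    rw [ha, hb] at e1
    have hc : c = 0 := by norm_num at e1; linarith
    rw [hR, ha, hb, hc]; simp
  · have ha : a = 0 := hz 4 (by norm_num)
    rw [ha] at e1
    have hb : b = 3 * c := by norm_num at e1; linarith
    rw [hR, ha, hb]
    simp [smallInvariant]; ring
  · have ha : a = 0 := hz 4 (by norm_num)
    rw [ha] at e1
    have hb : b = -9 * c := by norm_num at e1; linarith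
    rw [hR, ha, hb]
    simp [smallInvariant]; ring
  · have ha : a = 9 * c := by norm_num at e1 e2; linarith
    have hb : b = 6 * c := by norm_num at e1 e2; linarith
    rw [hR, ha, hb]
    simp [smallInvariant]; ring

lemma coeff_orbitForm_pow_mul_expand (e j : ℕ) (K : ℚ[X]) :
    (orbitForm ^ e * expand ℚ 2 K).coeff (e + 2 * j) = ((1 - X) ^ e * K).coeff j := by
  have : orbitForm ^ e * expand ℚ 2 K = X ^ e * expand ℚ 2 ((1 - X) ^ e * K) := by
    simp [orbitForm, mul_pow, mul_assoc]
  rw [this, add_comm, coeff_X_pow_mul, mul_comm 2 j, coeff_expand_mul (by norm_num)]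

end Mobius

end

/-! ### The difference polynomial of two coordinate sets and its consequences. -/

section

section Design
open Polynomial Filter

variable {F : Type*} [Field F] [Fintype F] {n : ℕ}

/-- The generating polynomial of the differences `cntDiff C T T'`. -/
def diffPoly (C : Submodule F (Fin n → F)) (T T' : Finset (Fin n)) : ℚ[X] :=
  ∑ j ∈ range (n - 2 * #T + 1), Polynomial.C (cntDiff C T T' (#T + j)) * X ^ j

lemma diffPoly_coeff (C : Submodule F (Fin n → F)) {T T' : Finset (Fin n)} (hT : #T = #T')
    (hreg : ∀ w, ∀ j < #T, Regular C w j) (j : ℕ) :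
    (diffPoly C T T').coeff j = cntDiff C T T' (#T + j) := by
  rw [diffPoly, finsetSum_coeff]
  simp only [coeff_C_mul, coeff_X_pow, mul_ite, mul_one, mul_zero, Finset.sum_ite_eq, mem_range]
  split_ifs with h
  · rfl
  · exact (cntDiff_eq_zero_of_gt C hT (hreg _) (by omega)).symm

lemma natDegree_diffPoly_le (C : Submodule F (Fin n → F)) (T T' : Finset (Fin n)) :
    (diffPoly C T T').natDegree ≤ n - 2 * #T := by
  refine natDegree_sum_le_of_forall_le _ _ fun j hj => ?_
  exact (natDegree_C_mul_X_pow_le _ _).trans (Nat.lt_succ_iff.1 (mem_range.1 hj))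

/-- The differences vanish below weight t and above weight n - t, so the homogeneous form is
divisible by (AB)^t. -/
lemma enum_sub_eq (C : Submodule F (Fin n → F)) {T T' : Finset (Fin n)} (hT : #T = #T')
    (hreg : ∀ w, ∀ j < #T, Regular C w j) (hn : 2 * #T ≤ n) {A B : ℚ} (hA : A ≠ 0) :
    enum C T A B - enum C T' A B
      = A ^ #T * B ^ #T * (A ^ (n - 2 * #T) * (diffPoly C T T').eval (B / A)) := by
  rw [enum_eq_sum, enum_eq_sum, ← Finset.sum_sub_distrib]
  simp only [← sub_mul]
  change ∑ w ∈ range (n + 1), cntDiff C T T' w * _ = _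
  rw [show n + 1 = #T + ((n - 2 * #T + 1) + #T) by omega, Finset.sum_range_add,
    Finset.sum_range_add, Finset.sum_eq_zero (s := range #T), Finset.sum_eq_zero (s := range #T),
    zero_add, add_zero, diffPoly, eval_finsetSum, Finset.mul_sum, Finset.mul_sum]
  · refine Finset.sum_congr rfl fun j hj => ?_
    have hj' := mem_range.1 hj
    rw [eval_mul, eval_C, eval_pow, eval_X, div_pow, show n - (#T + j) = #T + (n - 2 * #T - j) by omega,
      ← Nat.sub_add_cancel (show j ≤ n - 2 * #T by omega), pow_add A (n - 2 * #T - j) j,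
      Nat.add_sub_cancel, pow_add, pow_add]
    field_simp
  · intro j hj
    rw [cntDiff_eq_zero_of_gt C hT (hreg _) (by omega), zero_mul]
  · intro j hj
    rw [cntDiff_eq_zero_of_lt C hT (mem_range.1 hj), zero_mul]

lemma diffPoly_mobiusInv (hF : Fintype.card F = 4) {C : Submodule F (Fin n → F)}
    (hC : (C : Set (Fin n → F)) = hermitianDual C) {T T' : Finset (Fin n)} (hT : #T = #T')
    (hreg : ∀ w, ∀ j < #T, Regular C w j) (hn : 2 * #T ≤ n) :
    MobiusInv (n - 2 * #T) ((-1) ^ #T) (diffPoly C T T') := by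
  refine ⟨natDegree_diffPoly_le C T T', ?_⟩
  have h0 : ∀ᶠ y : ℚ in cofinite, y ≠ 0 := (Set.finite_singleton (0 : ℚ)).subset (by intro y; simp)
  have h1 : ∀ᶠ y : ℚ in cofinite, 1 - y ≠ 0 :=
    (Set.finite_singleton (1 : ℚ)).subset (fun y hy => by
      simp only [Set.mem_compl_iff, Set.mem_ofPred_eq, ne_eq, not_not] at hy
      exact (sub_eq_zero.1 hy).symm)
  filter_upwards [eventually_one_add_three_mul_ne, h0, h1] with y hA hy hB
  have key := enum_sub_transform hF hC hT hreg 1 y hA hB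
  rw [enum_sub_eq C hT hreg hn one_ne_zero, enum_sub_eq C hT hreg hn hA] at key
  simp only [one_pow, one_mul, mul_one, div_one] at key
  -- The factors taken out of the transformed form cancel the denominators. What is left, (-4y)^t,
  -- supplies the sign (-1)^t and lowers 2^n to 2^(n-2t).
  have e1 : (-(4 * y) / ((1 + 3 * y) * (1 - y))) ^ #T * ((1 + 3 * y) ^ #T * (1 - y) ^ #T)
      = (-1) ^ #T * (2 ^ #T * 2 ^ #T) * y ^ #T := by
    rw [← mul_pow, ← mul_pow, ← mul_pow, ← mul_pow, ← mul_pow]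
    congr 1
    rw [div_mul_cancel₀ _ (mul_ne_zero hA hB)]
    ring
  have e2 : (2 : ℚ) ^ n = 2 ^ (n - 2 * #T) * (2 ^ #T * 2 ^ #T) := by
    rw [← pow_add, ← pow_add]; congr 1; omega
  have e3 : ((-1 : ℚ) ^ #T) * (-1) ^ #T = 1 := by rw [← mul_pow]; norm_num
  rw [← mul_assoc _ (_ * _), e1, e2] at key
  have hne : (2 ^ #T * 2 ^ #T * y ^ #T : ℚ) ≠ 0 := by positivity
  refine mul_left_cancel₀ hne ?_
  linear_combination (-(-1 : ℚ) ^ #T) * key - (2 ^ #T * 2 ^ #T * y ^ #T) *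
    ((1 + 3 * y) ^ (n - 2 * #T) * (diffPoly C T T').eval ((1 - y) / (1 + 3 * y))) * e3

lemma diffPoly_comp_neg {C : Submodule F (Fin n → F)} (hC : ∀ x ∈ C, 2 ∣ hammingNorm x)
    {T T' : Finset (Fin n)} (hT : #T = #T') (hreg : ∀ w, ∀ j < #T, Regular C w j) :
    (diffPoly C T T').comp (-X) = Polynomial.C ((-1) ^ #T) * diffPoly C T T' := by
  ext j
  rw [comp_neg_X_coeff, coeff_C_mul, diffPoly_coeff C hT hreg]
  by_cases h : 2 ∣ #T + j
  · congr 1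
    rcases Nat.even_or_odd #T with h1 | h1
    · have h2 : Even j := by have := even_iff_two_dvd.2 h; grind
      rw [h1.neg_one_pow, h2.neg_one_pow]
    · have h2 : Odd j := by have := even_iff_two_dvd.2 h; grind
      rw [h1.neg_one_pow, h2.neg_one_pow]
  · rw [cntDiff, cnt_eq_zero_of_odd hC _ h, cnt_eq_zero_of_odd hC _ h]
    simp

lemma X_pow_dvd_diffPoly {C : Submodule F (Fin n → F)} {d : ℕ} (hmin : IsMinDist C d)
    {T T' : Finset (Fin n)} (hT : #T = #T') (hreg : ∀ w, ∀ j < #T, Regular C w j) :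
    X ^ (d - #T) ∣ diffPoly C T T' := by
  rw [X_pow_dvd_iff]
  intro j hj
  rw [diffPoly_coeff C hT hreg]
  rcases Nat.eq_zero_or_pos (#T + j) with h | h
  · rw [h, cntDiff_zero C hT]
  · rw [cntDiff, cnt_eq_zero_of_lt hmin _ (by omega) h, cnt_eq_zero_of_lt hmin _ (by omega) h, sub_self]

lemma regular_of_diffPoly_eq_zero {C : Submodule F (Fin n → F)} {t : ℕ}
    (hreg : ∀ w, ∀ j < t, Regular C w j)
    (h : ∀ T T' : Finset (Fin n), #T = t → #T' = t → diffPoly C T T' = 0) (w : ℕ) :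
    Regular C w t := by
  intro T T' hT hT'
  have hc : #T = #T' := hT.trans hT'.symm
  have : cntDiff C T T' w = 0 := by
    rcases Nat.lt_or_ge w #T with hw | hw
    · exact cntDiff_eq_zero_of_lt C hc hw
    · obtain ⟨j, rfl⟩ := Nat.exists_eq_add_of_le hw
      rw [← diffPoly_coeff C hc (by rwa [hT]), h T T' hT hT', coeff_zero]
  rw [cntDiff, sub_eq_zero] at this
  exact_mod_cast this

/-- The degree n - 2t of the difference polynomial is smaller than the degree 3(d - t) of the power
of `orbitForm` that divides it. -/
theorem regular_of_add_lt (hF : Fintype.card F = 4) {C : Submodule F (Fin n → F)}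
    (hC : IsTypeIV C) {d : ℕ} (hmin : IsMinDist C d) {t : ℕ} (hn : 2 * t ≤ n) (htd : t ≤ d)
    (hreg : ∀ w, ∀ j < t, Regular C w j) (hlt : n + t < 3 * d) (w : ℕ) : Regular C w t := by
  refine regular_of_diffPoly_eq_zero hreg (fun T T' hT hT' => ?_) w
  have hc : #T = #T' := hT.trans hT'.symm
  rw [← hT] at hreg hn htd hlt
  exact (diffPoly_mobiusInv hF hC.1 hc hreg hn).eq_zero (e := d - #T) (by simp)
    (δ := (-1) ^ #T) (by simp) (diffPoly_comp_neg hC.2 hc hreg) (X_pow_dvd_diffPoly hmin hc hreg)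
    (by omega)

/-- The parity conditions on d and t + r identify the signs (-1)^(d-t), (-1)^t and (-1)^r. The
quotient by `orbitForm ^ (d - t)` is then an even relative invariant of degree r, unique up to a
scalar. -/
lemma diffPoly_eq (hF : Fintype.card F = 4) {C : Submodule F (Fin n → F)}
    (hC : IsTypeIV C) {d : ℕ} (hmin : IsMinDist C d) {r : ℕ} (hr : r ≤ 4)
    {T T' : Finset (Fin n)} (hT : #T = #T') (hd : Even d) (hn : 2 * #T ≤ n) (htd : #T ≤ d)
    (hreg : ∀ w, ∀ j < #T, Regular C w j) (heq : n + #T = 3 * d + r) (hrt : Even (#T + r)) :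
    ∃ c, diffPoly C T T' = Polynomial.C c * (orbitForm ^ (d - #T) * expand ℚ 2 (smallInvariant r)) := by
  have h1 := diffPoly_mobiusInv hF hC.1 hT hreg hn
  have h2 := diffPoly_comp_neg hC.2 hT hreg
  have p1 : ((-1 : ℚ) ^ #T) = (-1) ^ (d - #T) := by
    rcases Nat.even_or_odd #T with h | h
    · rw [h.neg_one_pow, ((Nat.even_sub htd).2 (iff_of_true hd h)).neg_one_pow]
    · rw [h.neg_one_pow, (Nat.Even.sub_odd htd hd h).neg_one_pow]
  have p2 : ((-1 : ℚ) ^ #T) = (-1) ^ r := by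
    rcases Nat.even_or_odd #T with h | h
    · rw [h.neg_one_pow, ((Nat.even_add.1 hrt).1 h).neg_one_pow]
    · rw [h.neg_one_pow, (Nat.not_even_iff_odd.1 fun h' => Nat.not_even_iff_odd.2 h
        ((Nat.even_add.1 hrt).2 h')).neg_one_pow]
  rw [show n - 2 * #T = 3 * (d - #T) + r by omega] at h1
  rw [p1] at h2
  obtain ⟨R, hR, hinv, hpar⟩ := h1.exists_quotient (by simp) h2 (X_pow_dvd_diffPoly hmin hT hreg)
  rw [p2] at hinv
  obtain ⟨c, hc⟩ := hinv.eq_smallInvariant hr hpar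
  exact ⟨c, by rw [hR, hc]; ring⟩

theorem regular_of_add_eq (hF : Fintype.card F = 4) {C : Submodule F (Fin n → F)}
    (hC : IsTypeIV C) {d : ℕ} (hmin : IsMinDist C d) {t : ℕ} (hd : Even d) (hn : 2 * t ≤ n)
    (htd : t ≤ d) (hreg : ∀ w, ∀ j < t, Regular C w j) (heq : n + t = 3 * d + 1) (ht : Odd t)
    (w : ℕ) : Regular C w t := by
  refine regular_of_diffPoly_eq_zero hreg (fun T T' hT hT' => ?_) w
  have hc : #T = #T' := hT.trans hT'.symm
  rw [← hT] at hreg hn htd heq ht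
  obtain ⟨c, h⟩ := diffPoly_eq hF hC hmin (r := 1) (by norm_num) hc hd hn htd hreg heq ht.add_one
  rw [h]
  simp [smallInvariant]

/-- One regular weight forces all weights to be regular, when the corresponding coefficient of
the unique invariant does not vanish. -/
theorem regular_of_regular (hF : Fintype.card F = 4) {C : Submodule F (Fin n → F)}
    (hC : IsTypeIV C) {d : ℕ} (hmin : IsMinDist C d) {r t : ℕ} (hr : r ≤ 4) (hd : Even d)
    (hn : 2 * t ≤ n) (htd : t ≤ d) (hreg : ∀ w, ∀ j < t, Regular C w j)
    (heq : n + t = 3 * d + r) (hrt : Even (t + r)) {j : ℕ}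
    (hj : ((1 - X) ^ (d - t) * smallInvariant r).coeff j ≠ 0) (h : Regular C (d + 2 * j) t)
    (w : ℕ) : Regular C w t := by
  refine regular_of_diffPoly_eq_zero hreg (fun T T' hT hT' => ?_) w
  have hc : #T = #T' := hT.trans hT'.symm
  have h0 := h T T' hT hT'
  rw [← hT] at hreg hn htd heq hrt hj
  obtain ⟨c, hp⟩ := diffPoly_eq hF hC hmin hr hc hd hn htd hreg heq hrt
  have h1 := congrArg (fun q => coeff q (d - #T + 2 * j)) hp
  simp only [coeff_C_mul, coeff_orbitForm_pow_mul_expand] at h1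
  rw [diffPoly_coeff C hc hreg, cntDiff, show #T + (d - #T + 2 * j) = d + 2 * j by omega, h0,
    sub_self] at h1
  rcases mul_eq_zero.1 h1.symm with h2 | h2
  · rw [hp, h2, map_zero, zero_mul]
  · exact absurd h2 hj

end Design

end

/-! ### Nonvanishing of coefficients, and the possible values of δ and s. -/

section

section Coefficients
open Polynomial

lemma coeff_one_sub_X_pow (e j : ℕ) :
    ((1 - X : ℚ[X]) ^ e).coeff j = (-1) ^ j * (e.choose j : ℚ) := by
  rw [show (1 - X : ℚ[X]) ^ e = ((1 + X) ^ e).comp (-X) by simp [sub_eq_add_neg],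
    comp_neg_X_coeff, coeff_one_add_X_pow]

/-- The bound on j covers exactly the weights d + 2j ≤ n - t when e = d - t. For r = 3 the two
binomial terms have the same sign; for r = 2 a zero would force e = 4j + 3 at the shifted index,
contrary to evenness. For r = 4 a zero means a quadratic equation in the index, excluded for e = 16,
24, 34 one index at a time. -/
lemma coeff_one_sub_X_pow_mul_smallInvariant_ne_zero {r e j : ℕ}
    (hr : r = 0 ∨ r = 2 ∧ Even e ∨ r = 3 ∨ r = 4 ∧ (e = 16 ∨ e = 24 ∨ e = 34))
    (hj : 2 * j ≤ 2 * e + r) : ((1 - X) ^ e * smallInvariant r).coeff j ≠ 0 := by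
  have hpos : ∀ i ≤ e, (0 : ℚ) < e.choose i := fun i hi => by exact_mod_cast Nat.choose_pos hi
  rcases hr with rfl | ⟨rfl, he⟩ | rfl | ⟨rfl, he⟩
  · rw [smallInvariant, mul_one, coeff_one_sub_X_pow]
    have := hpos j (by omega)
    positivity
  · rw [smallInvariant, mul_add, mul_one, mul_left_comm, coeff_add, coeff_C_mul]
    rcases j with _ | j
    · simp [coeff_zero_eq_eval_zero]
    · rw [coeff_mul_X, coeff_one_sub_X_pow, coeff_one_sub_X_pow]
      intro h
      have h1 : (e.choose (j + 1) : ℚ) = 3 * e.choose j := by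
        have : (-1 : ℚ) ^ j * (3 * e.choose j - e.choose (j + 1)) = 0 := by
          rw [← h]; ring
        rcases mul_eq_zero.1 this with h | h
        · exact absurd h (pow_ne_zero _ (by norm_num))
        · linarith
      have h2 := Nat.choose_succ_right_eq e j
      have h1' : e.choose (j + 1) = 3 * e.choose j := by exact_mod_cast h1
      have h3 : 0 < e.choose j := Nat.choose_pos (by omega)
      rw [h1', mul_comm 3, mul_assoc] at h2
      have h4 := Nat.eq_of_mul_eq_mul_left h3 h2
      obtain ⟨k, rfl⟩ := he
      omega
  · rw [smallInvariant, mul_sub, mul_one, mul_left_comm, coeff_sub, coeff_C_mul]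
    rcases j with _ | j
    · simp [coeff_zero_eq_eval_zero]
    · rw [coeff_mul_X, coeff_one_sub_X_pow, coeff_one_sub_X_pow]
      intro h
      have : (-1 : ℚ) ^ j * (9 * e.choose j + e.choose (j + 1)) = 0 := by
        rw [← neg_eq_zero, ← h]; ring
      rcases mul_eq_zero.1 this with h | h
      · exact absurd h (pow_ne_zero _ (by norm_num))
      · have := hpos j (by omega)
        have h5 : (0 : ℚ) ≤ e.choose (j + 1) := Nat.cast_nonneg _
        linarith
  · rw [smallInvariant, mul_add, mul_add, mul_one, mul_left_comm, mul_left_comm ((1 - X) ^ e) (C 9),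
      coeff_add, coeff_add, coeff_C_mul, coeff_C_mul, coeff_mul_X_pow']
    rcases j with _ | _ | j
    · simp [coeff_zero_eq_eval_zero]
    · rw [coeff_mul_X, coeff_one_sub_X_pow, coeff_one_sub_X_pow]
      rcases he with rfl | rfl | rfl <;> norm_num
    · rw [coeff_mul_X, if_pos (by omega), show j + 1 + 1 - 2 = j from rfl, coeff_one_sub_X_pow,
        coeff_one_sub_X_pow, coeff_one_sub_X_pow]
      intro h
      have h1 : (-1 : ℚ) ^ j * (e.choose (j + 2) + 9 * e.choose j - 6 * e.choose (j + 1)) = 0 := by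
        rw [← h]; ring
      have h2 : (e.choose (j + 2) + 9 * e.choose j : ℚ) = 6 * e.choose (j + 1) := by
        rcases mul_eq_zero.1 h1 with h | h
        · exact absurd h (pow_ne_zero _ (by norm_num))
        · linarith
      have h3 : e.choose (j + 2) + 9 * e.choose j = 6 * e.choose (j + 1) := by exact_mod_cast h2
      have hje : j ≤ e := by omega
      have h4 := Nat.choose_succ_right_eq e j
      have h5 := Nat.choose_succ_right_eq e (j + 1)
      have h6 : 0 < e.choose j := Nat.choose_pos hje
      clear hj h h1 h2 hpos
      rw [show j + 1 + 1 = j + 2 by rfl] at h5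
      generalize e.choose j = c₀ at *
      generalize e.choose (j + 1) = c₁ at *
      generalize e.choose (j + 2) = c₂ at *
      -- For each fixed e and j the ratios of consecutive binomials are numbers, so the relations
      -- are linear in c₀, c₁, c₂ and are inconsistent with c₀ > 0.
      rcases he with rfl | rfl | rfl <;> interval_cases j <;> omega

end Coefficients

variable {F : Type*} [Field F] [Fintype F] {n : ℕ}

/-- Every size j below t = 3d - n has n + j < 3d, so strong induction uses only the case in which
the difference polynomial is forced to vanish. -/
lemma regular_of_le (hF : Fintype.card F = 4) {C : Submodule F (Fin n → F)}
    (hC : IsTypeIV C) {d : ℕ} (hmin : IsMinDist C d) {t : ℕ} (ht0 : n + t = 3 * d)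
    (htd : t ≤ d) (w : ℕ) (j : ℕ) (hj : j < t) : Regular C w j := by
  induction j using Nat.strong_induction_on generalizing w with
  | _ j ih =>
    exact regular_of_add_lt hF hC hmin (by omega) (by omega)
      (fun w i hi => ih i hi w (by omega)) (by omega) w

lemma deltaSEq_of_not_regular (hF : Fintype.card F = 4) {C : Submodule F (Fin n → F)}
    (hC : IsTypeIV C) {d : ℕ} (hmin : IsMinDist C d) (hd : Even d) (hd0 : 0 < d) (hne : Even n)
    {v r : ℕ} (heq : n + (v + 1) = 3 * d + r) (hvd : v + 1 ≤ d) (hvn : 2 * (v + 1) ≤ n)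
    (hr : r = 0 ∨ r = 2 ∨ r = 3 ∨
      r = 4 ∧ (d - (v + 1) = 16 ∨ d - (v + 1) = 24 ∨ d - (v + 1) = 34))
    (hreg : ∀ w, ∀ j ≤ v, Regular C w j) (hnot : ¬ Regular C d (v + 1)) : DeltaSEq C v := by
  have hpar : Even (v + 1 + r) := by
    obtain ⟨a, rfl⟩ := hd
    obtain ⟨b, rfl⟩ := hne
    exact ⟨3 * a + r - b, by omega⟩
  refine deltaSEq_of_regular hd0 hvd hmin hreg ?_ hnot
  rintro w hdw hwn ⟨x, hx, rfl⟩ h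
  obtain ⟨k, hk⟩ := hC.2 x hx
  obtain ⟨l, rfl⟩ := hd
  -- The weight of x exceeds d = 2l by an even amount, and half of it is the index of the
  -- coefficient that must not vanish.
  have hw : hammingNorm x = l + l + 2 * (k - l) := by omega
  rw [hw] at h
  refine regular_of_regular hF hC hmin (r := r) (by omega) ⟨l, rfl⟩ hvn hvd
    (fun w j hj => hreg w j (by omega)) heq hpar
    (coeff_one_sub_X_pow_mul_smallInvariant_ne_zero ?_ (by omega)) h _
  rcases hr with h | h | h | h
  · exact Or.inl h
  · refine Or.inr (Or.inl ⟨h, ?_⟩)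
    subst h
    obtain ⟨a, ha⟩ := hpar
    exact ⟨l - (a - 1), by omega⟩
  · exact Or.inr (Or.inr (Or.inl h))
  · exact Or.inr (Or.inr (Or.inr h))

/-- The minimum weight corresponds to the lowest coefficient, which is the constant term 1 of the
small invariant; its regularity alone kills the scalar. -/
lemma regular_succ (hF : Fintype.card F = 4) {C : Submodule F (Fin n → F)}
    (hC : IsTypeIV C) {d : ℕ} (hmin : IsMinDist C d) (hd : Even d) (hne : Even n)
    {t r : ℕ} (heq : n + t = 3 * d + r) (htd : t ≤ d) (htn : 2 * t ≤ n)
    (hr : r = 0 ∨ r = 2 ∨ r = 3) (hreg : ∀ w, ∀ j < t, Regular C w j) (h : Regular C d t) (w : ℕ) :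
    Regular C w t := by
  have hpar : Even (t + r) := by
    obtain ⟨a, rfl⟩ := hd
    obtain ⟨b, rfl⟩ := hne
    exact ⟨3 * a + r - b, by omega⟩
  refine regular_of_regular hF hC hmin (r := r) (by omega) hd htn htd hreg heq hpar
    (j := 0) ?_ h w
  rcases hr with rfl | rfl | rfl <;>
    simp [smallInvariant, Polynomial.coeff_zero_eq_eval_zero]

/-- The possible values of `δ = s`, depending on the first `t` for which the codewords of
minimum weight `d` cannot form a `t`-design. -/
theorem deltaSEq_ladder (hF : Fintype.card F = 4) {C : Submodule F (Fin n → F)} (hC : IsTypeIV C)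
    {d : ℕ} (hmin : IsMinDist C d) (hd : Even d) (hne : Even n) {t : ℕ}
    (ht : n + (t + 1) = 3 * d) :
    (t + 1 ≤ d → 2 * (t + 1) ≤ n → ¬ Regular C d (t + 1) → DeltaSEq C t) ∧
    (t + 3 ≤ d → 2 * (t + 3) ≤ n → ¬ Regular C d (t + 3) → DeltaSEq C t ∨ DeltaSEq C (t + 2)) ∧
    (t + 4 ≤ d → 2 * (t + 4) ≤ n → ¬ Regular C d (t + 4) →
      DeltaSEq C t ∨ DeltaSEq C (t + 2) ∨ DeltaSEq C (t + 3)) ∧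
    (t + 5 ≤ d → 2 * (t + 5) ≤ n → d - (t + 5) = 16 ∨ d - (t + 5) = 24 ∨ d - (t + 5) = 34 →
      ¬ Regular C d (t + 5) →
      DeltaSEq C t ∨ DeltaSEq C (t + 2) ∨ DeltaSEq C (t + 3) ∨ DeltaSEq C (t + 4)) := by
  have h0 : t + 1 ≤ d → ∀ w, ∀ j < t + 1, Regular C w j := fun htd w j hj =>
    regular_of_le hF hC hmin ht htd w j hj
  have b0 : t + 1 ≤ d → 2 * (t + 1) ≤ n → ¬ Regular C d (t + 1) → DeltaSEq C t :=
    fun htd htn h => deltaSEq_of_not_regular hF hC hmin hd (by omega) hne (r := 0) ht htd htn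
      (Or.inl rfl) (fun w j hj => h0 htd w j (by omega)) h
  -- The size t + 2 has r = 1, where no nonzero invariant exists. Regularity therefore jumps from t
  -- + 1 to t + 2, and t + 1 is never the value of δ and s here.
  have hodd : Odd (t + 2) := by
    obtain ⟨a, rfl⟩ := hd
    obtain ⟨b, rfl⟩ := hne
    exact ⟨3 * a - b, by omega⟩
  have h2 : t + 2 ≤ d → 2 * (t + 2) ≤ n → Regular C d (t + 1) →
      ∀ w, ∀ j < t + 3, Regular C w j := by
    intro htd htn h
    have h1 : ∀ w, ∀ j < t + 2, Regular C w j := by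
      intro w j hj
      rcases Nat.lt_succ_iff_lt_or_eq.1 hj with hj | rfl
      · exact h0 (by omega) w j hj
      · exact regular_succ hF hC hmin hd hne (r := 0) ht (by omega) (by omega) (Or.inl rfl)
          (h0 (by omega)) h w
    intro w j hj
    rcases Nat.lt_succ_iff_lt_or_eq.1 hj with hj | rfl
    · exact h1 w j hj
    · exact regular_of_add_eq hF hC hmin hd htn htd h1 (by omega) hodd w
  have h3 : t + 3 ≤ d → 2 * (t + 3) ≤ n → Regular C d (t + 1) → Regular C d (t + 3) →
      ∀ w, ∀ j < t + 4, Regular C w j := by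
    intro htd htn h h' w j hj
    rcases Nat.lt_succ_iff_lt_or_eq.1 hj with hj | rfl
    · exact h2 (by omega) (by omega) h w j hj
    · exact regular_succ hF hC hmin hd hne (r := 2) (by omega) htd htn (by omega)
        (h2 (by omega) (by omega) h) h' w
  have h4 : t + 4 ≤ d → 2 * (t + 4) ≤ n → Regular C d (t + 1) → Regular C d (t + 3) →
      Regular C d (t + 4) → ∀ w, ∀ j < t + 5, Regular C w j := by
    intro htd htn h h' h'' w j hj
    rcases Nat.lt_succ_iff_lt_or_eq.1 hj with hj | rfl
    · exact h3 (by omega) (by omega) h h' w j hj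
    · exact regular_succ hF hC hmin hd hne (r := 3) (by omega) htd htn (by omega)
        (h3 (by omega) (by omega) h h') h'' w
  have b2 : t + 3 ≤ d → 2 * (t + 3) ≤ n → Regular C d (t + 1) → ¬ Regular C d (t + 3) →
      DeltaSEq C (t + 2) := fun htd htn h h' =>
    deltaSEq_of_not_regular hF hC hmin hd (by omega) hne (r := 2) (by omega) htd htn
      (by omega) (fun w j hj => h2 (by omega) (by omega) h w j (by omega)) h'
  have b3 : t + 4 ≤ d → 2 * (t + 4) ≤ n → Regular C d (t + 1) → Regular C d (t + 3) →
      ¬ Regular C d (t + 4) → DeltaSEq C (t + 3) := fun htd htn h h' h'' =>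
    deltaSEq_of_not_regular hF hC hmin hd (by omega) hne (r := 3) (by omega) htd htn
      (by omega) (fun w j hj => h3 (by omega) (by omega) h h' w j (by omega)) h''
  refine ⟨b0, fun htd htn h => ?_, fun htd htn h => ?_, fun htd htn he h => ?_⟩
  · by_cases r0 : Regular C d (t + 1)
    · exact Or.inr (b2 htd htn r0 h)
    · exact Or.inl (b0 (by omega) (by omega) r0)
  · by_cases r0 : Regular C d (t + 1)
    · by_cases r2 : Regular C d (t + 3)
      · exact Or.inr (Or.inr (b3 htd htn r0 r2 h))
      · exact Or.inr (Or.inl (b2 (by omega) (by omega) r0 r2))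
    · exact Or.inl (b0 (by omega) (by omega) r0)
  · by_cases r0 : Regular C d (t + 1)
    · by_cases r2 : Regular C d (t + 3)
      · by_cases r3 : Regular C d (t + 4)
        · exact Or.inr (Or.inr (Or.inr (deltaSEq_of_not_regular hF hC hmin hd (by omega) hne
            (r := 4) (by omega) htd htn (by omega)
            (fun w j hj => h4 (by omega) (by omega) r0 r2 r3 w j (by omega)) h)))
        · exact Or.inr (Or.inr (Or.inl (b3 (by omega) (by omega) r0 r2 r3)))
      · exact Or.inr (Or.inl (b2 (by omega) (by omega) r0 r2))
    · exact Or.inl (b0 (by omega) (by omega) r0)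

end

/-! ### Lagrange inversion and linear relations for coefficients of invariants. -/

section

section Lagrange
open PowerSeries

/-- The geometric series `1 / (1 - X)`. -/
def geom : ℚ⟦X⟧ := PowerSeries.mk 1

lemma geom_mul_one_sub : geom * (1 - X) = 1 := PowerSeries.mk_one_mul_one_sub_eq_one ℚ

lemma coeff_geom_pow (s j : ℕ) : coeff j (geom ^ (s + 1)) = ((s + j).choose s : ℚ) := by
  rw [geom, PowerSeries.mk_one_pow_eq_mk_choose_add, coeff_mk]

lemma derivative_geom : PowerSeries.derivative ℚ geom = geom ^ 2 := by
  have h := congrArg (PowerSeries.derivative ℚ) geom_mul_one_sub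
  simp only [Derivation.leibniz, map_sub, Derivation.map_one_eq_zero, PowerSeries.derivative_X,
    smul_eq_mul, zero_sub] at h
  linear_combination geom * h + (PowerSeries.derivative ℚ geom - geom * 0) * (-geom_mul_one_sub)

/-- A case of Lagrange inversion. -/
lemma coeff_lagrange {M : ℕ} (hM : 0 < M) :
    coeff M ((1 + 3 * X : ℚ⟦X⟧) ^ (3 * M - 1) * (1 - 9 * X) * geom ^ (2 * M + 1)) = 0 := by
  obtain ⟨k, rfl⟩ : ∃ k, M = k + 1 := ⟨M - 1, by omega⟩
  set G : ℚ⟦X⟧ := (1 + 3 * X) ^ (3 * (k + 1)) * geom ^ (2 * (k + 1)) with hG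
  have hd3 : PowerSeries.derivative ℚ (1 + 3 * X : ℚ⟦X⟧) = 3 := by
    have h3 : PowerSeries.derivative ℚ (3 : ℚ⟦X⟧) = 0 := by
      have := Derivation.map_natCast (PowerSeries.derivative ℚ) 3
      exact_mod_cast this
    simp [Derivation.leibniz, h3]
  have h1 : PowerSeries.derivative ℚ G
      = ((k + 1 : ℕ) : ℚ⟦X⟧) * (9 * (1 + 3 * X) ^ (3 * k + 2) * geom ^ (2 * (k + 1))
        + 2 * (1 + 3 * X) ^ (3 * (k + 1)) * geom ^ (2 * (k + 1) + 1)) := by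
    rw [hG, Derivation.leibniz, PowerSeries.derivative_pow, PowerSeries.derivative_pow, hd3,
      derivative_geom, smul_eq_mul, smul_eq_mul, show 3 * (k + 1) - 1 = 3 * k + 2 by omega,
      show 2 * (k + 1) - 1 = 2 * k + 1 by omega]
    push_cast
    ring
  -- M times the series equals M G - X G', where G = ((1 + 3X)^3 / (1 - X)^2)^M. The operator
  -- multiplies the coefficient of X^M by M - M = 0.
  have h2 : ((k + 1 : ℕ) : ℚ⟦X⟧) *
      ((1 + 3 * X : ℚ⟦X⟧) ^ (3 * (k + 1) - 1) * (1 - 9 * X) * geom ^ (2 * (k + 1) + 1))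
      = ((k + 1 : ℕ) : ℚ⟦X⟧) * G - X * PowerSeries.derivative ℚ G := by
    rw [h1, hG, show 3 * (k + 1) - 1 = 3 * k + 2 by omega,
      show 3 * (k + 1) = (3 * k + 2) + 1 by ring,
      pow_succ _ (3 * k + 2), pow_succ geom]
    generalize (1 + 3 * X : ℚ⟦X⟧) ^ (3 * k + 2) = q
    generalize geom ^ (2 * (k + 1)) = g
    linear_combination ((k + 1 : ℕ) : ℚ⟦X⟧) * (q * (1 + 3 * X) * g - 9 * X * q * g) *
      geom_mul_one_sub
  have h3 := congrArg (coeff (k + 1)) h2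
  rw [← nsmul_eq_mul, ← nsmul_eq_mul, map_nsmul, map_sub, map_nsmul, coeff_succ_X_mul,
    PowerSeries.coeff_derivative, nsmul_eq_mul, nsmul_eq_mul, mul_comm (coeff (k + 1) G)] at h3
  have h4 : ((k + 1 : ℕ) : ℚ) ≠ 0 := by positivity
  refine (mul_eq_zero.1 (h3.trans ?_)).resolve_left h4
  push_cast
  ring

open Polynomial in
lemma MobiusInv.sub_C_mul_pow {k : ℕ} {p : ℚ[X]} (h : MobiusInv (2 * k) 1 p) (c : ℚ) :
    MobiusInv (2 * k) 1 (p - Polynomial.C c * (1 + Polynomial.C 3 * Polynomial.X ^ 2) ^ k) := by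
  refine ⟨?_, ?_⟩
  · refine (natDegree_sub_le _ _).trans (max_le h.1 ((natDegree_C_mul_le _ _).trans ?_))
    refine natDegree_pow_le.trans ?_
    rw [mul_comm]
    refine Nat.mul_le_mul_right _ ?_
    compute_degree
  · filter_upwards [h.2, eventually_one_add_three_mul_ne] with y hy hy'
    simp only [eval_sub, eval_mul, eval_pow, eval_add, eval_one, eval_X, eval_C, mul_sub, hy, one_mul]
    congr 1
    rw [pow_mul, pow_mul, ← mul_assoc, mul_comm _ c, mul_assoc, ← mul_pow, mul_left_comm, ← mul_pow]
    congr 2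
    field_simp
    ring

/-- A linear relation between the coefficients of an invariant of degree `2 k`, obtained from its
expansion in powers of the invariant of degree 6. -/
theorem coeff_invariant {k : ℕ} {P : Polynomial ℚ} (h : MobiusInv (2 * k) 1 (Polynomial.expand ℚ 2 P))
    {M : ℕ} (hM : k < 3 * M) :
    coeff M ((P : ℚ⟦X⟧) *
      ((1 + 3 * X : ℚ⟦X⟧) ^ (3 * M - k - 1) * (1 - 9 * X) * geom ^ (2 * M + 1))) = 0 := by
  induction k using Nat.strong_induction_on generalizing P M with
  | _ k ih =>
    set c := P.coeff 0 with hc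
    -- Removing a power of the degree 2 invariant cancels the constant term. The rest is the degree
    -- 6 invariant X(1 - X)^2 (in the squared variable) times an invariant with k - 3 in place of k,
    -- and the relation for it has M - 1 in place of M. The removed power contributes zero by
    -- `coeff_lagrange`.
    set Q : Polynomial ℚ := P - Polynomial.C c * (1 + Polynomial.C 3 * Polynomial.X) ^ k with hQ
    have hQinv : MobiusInv (2 * k) 1 (Polynomial.expand ℚ 2 Q) := by
      have := h.sub_C_mul_pow c
      convert this using 1
      simp [hQ]
    have hpar : (Polynomial.expand ℚ 2 Q).comp (-Polynomial.X)
        = Polynomial.C ((-1) ^ 2) * Polynomial.expand ℚ 2 Q := by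
      rw [Polynomial.expand_eq_comp_X_pow, Polynomial.comp_assoc]
      simp
    have hQ0 : Q.coeff 0 = 0 := by
      simp [hQ, hc, Polynomial.coeff_zero_eq_eval_zero]
    have hdvd : (Polynomial.X : Polynomial ℚ) ^ 2 ∣ Polynomial.expand ℚ 2 Q := by
      obtain ⟨q, hq⟩ := Polynomial.X_dvd_iff.2 hQ0
      exact ⟨Polynomial.expand ℚ 2 q, by rw [hq]; simp⟩
    have hP : P = Polynomial.C c * (1 + Polynomial.C 3 * Polynomial.X) ^ k + Q := by
      rw [hQ]; ring
    have hfirst : coeff M (((Polynomial.C c * (1 + Polynomial.C 3 * Polynomial.X) ^ k :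
        Polynomial ℚ) : ℚ⟦X⟧) *
        ((1 + 3 * X : ℚ⟦X⟧) ^ (3 * M - k - 1) * (1 - 9 * X) * geom ^ (2 * M + 1))) = 0 := by
      have : ((Polynomial.C c * (1 + Polynomial.C 3 * Polynomial.X) ^ k : Polynomial ℚ) : ℚ⟦X⟧) *
        ((1 + 3 * X : ℚ⟦X⟧) ^ (3 * M - k - 1) * (1 - 9 * X) * geom ^ (2 * M + 1))
        = C c * ((1 + 3 * X : ℚ⟦X⟧) ^ (3 * M - 1) * (1 - 9 * X) * geom ^ (2 * M + 1)) := by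
        rw [show 3 * M - 1 = k + (3 * M - k - 1) by omega, pow_add]
        push_cast
        rw [show (C 3 : ℚ⟦X⟧) = 3 from rfl]
        ring
      rw [this, coeff_C_mul, coeff_lagrange (by omega), mul_zero]
    rw [hP]
    push_cast
    push_cast at hfirst
    rw [add_mul, map_add, hfirst, zero_add]
    rcases Nat.lt_or_ge k 3 with hk | hk
    · have hz := hQinv.eq_zero (e := 2) one_ne_zero (by norm_num) hpar hdvd (by omega)
      rw [Polynomial.expand_eq_zero (by norm_num)] at hz
      simp [hz]
    · obtain ⟨k', rfl⟩ := Nat.exists_eq_add_of_le' hk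
      rw [show 2 * (k' + 3) = 3 * 2 + 2 * k' by ring] at hQinv
      obtain ⟨R, hR, hRinv, hRpar⟩ := hQinv.exists_quotient one_ne_zero hpar hdvd
      have hRc : R = Polynomial.expand ℚ 2 (Polynomial.contract 2 R) := by
        ext j
        rw [Polynomial.coeff_expand (by norm_num)]
        split_ifs with h2
        · rw [Polynomial.coeff_contract (by norm_num), Nat.div_mul_cancel h2]
        · exact coeff_odd_eq_zero hRpar (Nat.not_even_iff_odd.1 fun h => h2 h.two_dvd)
      set S := Polynomial.contract 2 R
      have hQS : Q = Polynomial.X * (1 - Polynomial.X) ^ 2 * S := by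
        apply Polynomial.expand_injective (R := ℚ) (n := 2) (by norm_num)
        rw [hR]
        conv_lhs => rw [hRc]
        simp only [orbitForm, map_mul, map_pow, map_sub, map_one, Polynomial.expand_X]
        ring
      obtain ⟨M', rfl⟩ : ∃ M', M = M' + 1 := ⟨M - 1, by omega⟩
      have := ih k' (by omega) (P := S) (hRc ▸ hRinv) (M := M') (by omega)
      rw [hQS]
      push_cast
      rw [show 3 * (M' + 1) - (k' + 3) - 1 = 3 * M' - k' - 1 by omega,
        show 2 * (M' + 1) + 1 = (2 * M' + 1) + 2 by ring, pow_add geom]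
      rw [← this, ← coeff_succ_X_mul M']
      refine congrArg (coeff (R := ℚ) (M' + 1)) ?_
      generalize geom ^ (2 * M' + 1) = g
      linear_combination (X * (S : ℚ⟦X⟧) * (1 + 3 * X) ^ (3 * M' - k' - 1) * (1 - 9 * X) * g) *
        (geom * (1 - X) + 1) * geom_mul_one_sub

/-- If an invariant of degree `2 k` starts with `1` followed by zeros, its next coefficients
are determined. -/
lemma coeff_invariant_of_gap {k : ℕ} {P : Polynomial ℚ}
    (h : MobiusInv (2 * k) 1 (Polynomial.expand ℚ 2 P)) (h0 : P.coeff 0 = 1) {M : ℕ}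
    (hgap : ∀ i, 0 < i → i < M → P.coeff i = 0) {q : ℚ⟦X⟧} (hM : k < 3 * M)
    (hq : (1 + 3 * X : ℚ⟦X⟧) ^ (3 * M - k - 1) * (1 - 9 * X) = q) :
    coeff M (q * geom ^ (2 * M + 1)) + P.coeff M * coeff 0 q = 0 := by
  have h1 := coeff_invariant h hM
  rw [hq, coeff_mul, Finset.Nat.sum_antidiagonal_eq_sum_range_succ_mk, Finset.sum_range_succ,
    -- Because of the gap, only the coefficients of P with index 0 and M contribute to the
    -- convolution.
    Finset.sum_eq_single_of_mem 0 (by simp; omega)] at h1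
  · simpa [h0, geom] using h1
  · intro i hi hi0
    rw [Polynomial.coeff_coe, hgap i (Nat.pos_of_ne_zero hi0) (mem_range.1 hi), zero_mul]

lemma coeff_invariant_of_gap_succ {k : ℕ} {P : Polynomial ℚ}
    (h : MobiusInv (2 * k) 1 (Polynomial.expand ℚ 2 P)) (h0 : P.coeff 0 = 1) {M : ℕ} (hM0 : 0 < M)
    (hgap : ∀ i, 0 < i → i < M → P.coeff i = 0) {q : ℚ⟦X⟧} (hM : k < 3 * (M + 1))
    (hq : (1 + 3 * X : ℚ⟦X⟧) ^ (3 * (M + 1) - k - 1) * (1 - 9 * X) = q) :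
    coeff (M + 1) (q * geom ^ (2 * (M + 1) + 1)) + P.coeff M * (coeff 1 q + (2 * M + 3) * coeff 0 q)
      + P.coeff (M + 1) * coeff 0 q = 0 := by
  have h1 := coeff_invariant h hM
  rw [hq, coeff_mul, Finset.Nat.sum_antidiagonal_eq_sum_range_succ_mk, Finset.sum_range_succ,
    Finset.sum_range_succ, Finset.sum_eq_single_of_mem 0 (by simp; omega)] at h1
  · have h2 : coeff 1 (q * geom ^ (2 * (M + 1) + 1)) = coeff 1 q + (2 * M + 3) * coeff 0 q := by
      rw [coeff_mul, Finset.Nat.sum_antidiagonal_eq_sum_range_succ_mk, Finset.sum_range_succ,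
        Finset.sum_range_succ, Finset.sum_range_zero, coeff_geom_pow, coeff_geom_pow]
      simp only [Nat.sub_zero, Nat.sub_self, add_zero, Nat.choose_self, Nat.choose_succ_self_right]
      push_cast
      ring
    have h3 : coeff 0 (q * geom ^ (2 * (M + 1) + 1)) = coeff 0 q := by simp [geom]
    simp only [Polynomial.coeff_coe, h0, Nat.sub_zero, one_mul, Nat.sub_self, h3,
      Nat.add_sub_cancel_left, h2] at h1
    linarith
  · intro i hi hi0
    rw [Polynomial.coeff_coe, hgap i (Nat.pos_of_ne_zero hi0) (mem_range.1 hi), zero_mul]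

lemma coeff_C_mul_X_pow_mul_geom (c : ℚ) {i M : ℕ} (hi : i ≤ M) :
    coeff M (C c * X ^ i * geom ^ (2 * M + 1)) = c * ((3 * M - i).choose (2 * M) : ℚ) := by
  rw [mul_assoc, coeff_C_mul, coeff_X_pow_mul', if_pos hi, coeff_geom_pow,
    show 2 * M + (M - i) = 3 * M - i by omega]

end Lagrange

end

/-! ### Weight enumerators of extremal codes. -/

section

section WeightEnumerator
open Polynomial Filter

variable {F : Type*} [Field F] [Fintype F] {n : ℕ}

/-- The weight enumerator of a code at `x = 1`. -/
def weightPoly (C : Submodule F (Fin n → F)) : ℚ[X] :=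
  ∑ j ∈ range (n + 1), Polynomial.C (cnt C j ∅ : ℚ) * X ^ j

lemma cnt_eq_zero_of_length_lt (C : Submodule F (Fin n → F)) (T : Finset (Fin n)) {w : ℕ}
    (hw : n < w) : cnt C w T = 0 := by
  refine Finset.card_eq_zero.2 (Finset.eq_empty_of_forall_notMem fun x hx => ?_)
  simp only [mem_filter, mem_univ, true_and] at hx
  have := hammingNorm_le x
  omega

lemma weightPoly_coeff (C : Submodule F (Fin n → F)) (j : ℕ) :
    (weightPoly C).coeff j = cnt C j ∅ := by
  rw [weightPoly, finsetSum_coeff]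
  simp only [coeff_C_mul, coeff_X_pow, mul_ite, mul_one, mul_zero, Finset.sum_ite_eq, mem_range]
  split_ifs with h
  · rfl
  · rw [cnt_eq_zero_of_length_lt C ∅ (by omega), Nat.cast_zero]

lemma enum_empty_eq (C : Submodule F (Fin n → F)) {A B : ℚ} (hA : A ≠ 0) :
    enum C ∅ A B = A ^ n * (weightPoly C).eval (B / A) := by
  rw [enum_eq_sum, weightPoly, eval_finsetSum, Finset.mul_sum]
  refine Finset.sum_congr rfl fun j hj => ?_
  rw [eval_mul, eval_C, eval_pow, eval_X, div_pow,
    show A ^ n = A ^ (n - j) * A ^ j by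
      rw [← pow_add, Nat.sub_add_cancel (Nat.lt_succ_iff.1 (mem_range.1 hj))]]
  field_simp

lemma weightPoly_mobiusInv (hF : Fintype.card F = 4) {C : Submodule F (Fin n → F)}
    (hC : (C : Set (Fin n → F)) = hermitianDual C) : MobiusInv n 1 (weightPoly C) := by
  refine ⟨natDegree_sum_le_of_forall_le _ _ fun j hj =>
    (natDegree_C_mul_X_pow_le _ _).trans (Nat.lt_succ_iff.1 (mem_range.1 hj)), ?_⟩
  have h1 : ∀ᶠ y : ℚ in cofinite, 1 - y ≠ 0 :=
    (Set.finite_singleton (1 : ℚ)).subset (fun y hy => by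
      simp only [Set.mem_compl_iff, Set.mem_ofPred_eq, ne_eq, not_not] at hy
      exact (sub_eq_zero.1 hy).symm)
  filter_upwards [eventually_one_add_three_mul_ne, h1] with y hA hB
  have key := enum_transform hF hC ∅ 1 y hA hB
  simp only [powerset_empty, sum_singleton, card_empty, pow_zero, Nat.sub_self, one_mul] at key
  rw [enum_empty_eq C one_ne_zero, enum_empty_eq C hA] at key
  rw [← key]
  simp

lemma expand_contract_weightPoly {C : Submodule F (Fin n → F)}
    (hC : ∀ x ∈ C, 2 ∣ hammingNorm x) :
    expand ℚ 2 (contract 2 (weightPoly C)) = weightPoly C := by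
  ext j
  rw [coeff_expand (by norm_num)]
  split_ifs with h2
  · rw [coeff_contract (by norm_num), Nat.div_mul_cancel h2]
  · rw [weightPoly_coeff, cnt_eq_zero_of_odd hC _ h2, Nat.cast_zero]

/-- The number of codewords of minimum weight of an extremal code. -/
lemma cnt_min (hF : Fintype.card F = 4) {C : Submodule F (Fin n → F)}
    (hC : IsTypeIV C) {M k : ℕ} (hn : n = 2 * k) (hk : k < 3 * M) (hmin : IsMinDist C (2 * M))
    {q : PowerSeries ℚ} (hq : (1 + 3 * PowerSeries.X : PowerSeries ℚ) ^ (3 * M - k - 1) * (1 - 9 * PowerSeries.X) = q) :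
    PowerSeries.coeff M (q * geom ^ (2 * M + 1)) + cnt C (2 * M) ∅ * PowerSeries.coeff 0 q = 0 := by
  have h := weightPoly_mobiusInv hF hC.1
  rw [← expand_contract_weightPoly hC.2] at h
  subst hn
  have hco : ∀ i, (contract 2 (weightPoly C)).coeff i = cnt C (2 * i) ∅ := by
    intro i
    rw [coeff_contract (by norm_num), weightPoly_coeff, mul_comm i 2]
  rw [← hco]
  refine coeff_invariant_of_gap h ?_ (fun i hi hiM => ?_) hk hq
  · rw [hco, mul_zero, cnt_zero]; simp
  · rw [hco, cnt_eq_zero_of_lt hmin _ (by omega) (by omega), Nat.cast_zero]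

/-- The next number of codewords of an extremal code. -/
lemma cnt_min_add_two (hF : Fintype.card F = 4) {C : Submodule F (Fin n → F)}
    (hC : IsTypeIV C) {M k : ℕ} (hn : n = 2 * k) (hM0 : 0 < M) (hk : k < 3 * (M + 1))
    (hmin : IsMinDist C (2 * M))
    {q : PowerSeries ℚ} (hq : (1 + 3 * PowerSeries.X : PowerSeries ℚ) ^ (3 * (M + 1) - k - 1) * (1 - 9 * PowerSeries.X) = q) :
    PowerSeries.coeff (M + 1) (q * geom ^ (2 * (M + 1) + 1)) +
      cnt C (2 * M) ∅ * (PowerSeries.coeff 1 q + (2 * M + 3) * PowerSeries.coeff 0 q)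
      + cnt C (2 * (M + 1)) ∅ * PowerSeries.coeff 0 q = 0 := by
  have h := weightPoly_mobiusInv hF hC.1
  rw [← expand_contract_weightPoly hC.2] at h
  subst hn
  have hco : ∀ i, (contract 2 (weightPoly C)).coeff i = cnt C (2 * i) ∅ := by
    intro i
    rw [coeff_contract (by norm_num), weightPoly_coeff, mul_comm i 2]
  rw [← hco, ← hco]
  refine coeff_invariant_of_gap_succ h ?_ hM0 (fun i hi hiM => ?_) hk hq
  · rw [hco, mul_zero, cnt_zero]; simp
  · rw [hco, cnt_eq_zero_of_lt hmin _ (by omega) (by omega), Nat.cast_zero]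

end WeightEnumerator

/-! ### Numbers of codewords of the two lowest weights as sums of binomials. -/

section Formulas
open PowerSeries

variable {F : Type*} [Field F] [Fintype F] {n : ℕ}

/-- The constants are the coefficients of (1 + 3X)^2 (1 - 9X), where the exponent is 3M - k - 1 with
M = m + 1 and k = 3m. The formulas for the other lengths and for the next weight arise in the same
way from other exponents. -/
lemma cnt_min_six_mul (hF : Fintype.card F = 4) {C : Submodule F (Fin n → F)}
    (hC : IsTypeIV C) {m : ℕ} (hm : 2 ≤ m) (hn : n = 6 * m) (hmin : IsMinDist C (2 * m + 2)) :
    (cnt C (2 * m + 2) ∅ : ℚ) =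
      -(1) * ((3 * m + 3).choose (2 * m + 2) : ℚ) - (-3) * ((3 * m + 2).choose (2 * m + 2) : ℚ) - (-45) * ((3 * m + 1).choose (2 * m + 2) : ℚ) - (-81) * ((3 * m).choose (2 * m + 2) : ℚ) := by
  have hq : (1 + 3 * X : ℚ⟦X⟧) ^ (3 * (m + 1) - (3 * m) - 1) * (1 - 9 * X)
      = PowerSeries.C (1) * X ^ 0 + PowerSeries.C (-3) * X ^ 1 + PowerSeries.C (-45) * X ^ 2 + PowerSeries.C (-81) * X ^ 3 := by
    rw [show 3 * (m + 1) - (3 * m) - 1 = 2 by omega]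
    simp only [map_neg, map_one, map_ofNat]
    ring
  have h := cnt_min hF hC (M := m + 1) (k := 3 * m) (by omega) (by omega) hmin hq
  simp only [add_mul, map_add] at h
  rw [coeff_C_mul_X_pow_mul_geom _ (by omega), coeff_C_mul_X_pow_mul_geom _ (by omega), coeff_C_mul_X_pow_mul_geom _ (by omega), coeff_C_mul_X_pow_mul_geom _ (by omega)] at h
  rw [show 3 * (m + 1) - 0 = 3 * m + 3 by omega, show 3 * (m + 1) - 1 = 3 * m + 2 by omega, show 3 * (m + 1) - 2 = 3 * m + 1 by omega, show 3 * (m + 1) - 3 = 3 * m by omega,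
    show 2 * (m + 1) = 2 * m + 2 by ring] at h
  simp at h
  linarith

lemma cnt_min_six_mul_add_two (hF : Fintype.card F = 4) {C : Submodule F (Fin n → F)}
    (hC : IsTypeIV C) {m : ℕ} (hm : 1 ≤ m) (hn : n = 6 * m + 2) (hmin : IsMinDist C (2 * m + 2)) :
    (cnt C (2 * m + 2) ∅ : ℚ) =
      -(1) * ((3 * m + 3).choose (2 * m + 2) : ℚ) - (-6) * ((3 * m + 2).choose (2 * m + 2) : ℚ) - (-27) * ((3 * m + 1).choose (2 * m + 2) : ℚ) := by
  have hq : (1 + 3 * X : ℚ⟦X⟧) ^ (3 * (m + 1) - (3 * m + 1) - 1) * (1 - 9 * X)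
      = PowerSeries.C (1) * X ^ 0 + PowerSeries.C (-6) * X ^ 1 + PowerSeries.C (-27) * X ^ 2 := by
    rw [show 3 * (m + 1) - (3 * m + 1) - 1 = 1 by omega]
    simp only [map_neg, map_one, map_ofNat]
    ring
  have h := cnt_min hF hC (M := m + 1) (k := 3 * m + 1) (by omega) (by omega) hmin hq
  simp only [add_mul, map_add] at h
  rw [coeff_C_mul_X_pow_mul_geom _ (by omega), coeff_C_mul_X_pow_mul_geom _ (by omega), coeff_C_mul_X_pow_mul_geom _ (by omega)] at h
  rw [show 3 * (m + 1) - 0 = 3 * m + 3 by omega, show 3 * (m + 1) - 1 = 3 * m + 2 by omega, show 3 * (m + 1) - 2 = 3 * m + 1 by omega,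
    show 2 * (m + 1) = 2 * m + 2 by ring] at h
  simp at h
  linarith

lemma cnt_min_six_mul_add_four (hF : Fintype.card F = 4) {C : Submodule F (Fin n → F)}
    (hC : IsTypeIV C) {m : ℕ} (hm : 1 ≤ m) (hn : n = 6 * m + 4) (hmin : IsMinDist C (2 * m + 2)) :
    (cnt C (2 * m + 2) ∅ : ℚ) =
      -(1) * ((3 * m + 3).choose (2 * m + 2) : ℚ) - (-9) * ((3 * m + 2).choose (2 * m + 2) : ℚ) := by
  have hq : (1 + 3 * X : ℚ⟦X⟧) ^ (3 * (m + 1) - (3 * m + 2) - 1) * (1 - 9 * X)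
      = PowerSeries.C (1) * X ^ 0 + PowerSeries.C (-9) * X ^ 1 := by
    rw [show 3 * (m + 1) - (3 * m + 2) - 1 = 0 by omega]
    simp only [map_neg, map_one, map_ofNat]
    ring
  have h := cnt_min hF hC (M := m + 1) (k := 3 * m + 2) (by omega) (by omega) hmin hq
  simp only [add_mul, map_add] at h
  rw [coeff_C_mul_X_pow_mul_geom _ (by omega), coeff_C_mul_X_pow_mul_geom _ (by omega)] at h
  rw [show 3 * (m + 1) - 0 = 3 * m + 3 by omega, show 3 * (m + 1) - 1 = 3 * m + 2 by omega,
    show 2 * (m + 1) = 2 * m + 2 by ring] at h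
  simp at h
  linarith

lemma cnt_min_add_two_six_mul (hF : Fintype.card F = 4) {C : Submodule F (Fin n → F)}
    (hC : IsTypeIV C) {m : ℕ} (hm : 4 ≤ m) (hn : n = 6 * m) (hmin : IsMinDist C (2 * m + 2)) :
    (cnt C (2 * m + 4) ∅ : ℚ) =
      -(1) * ((3 * m + 6).choose (2 * m + 4) : ℚ) - (6) * ((3 * m + 5).choose (2 * m + 4) : ℚ) - (-45) * ((3 * m + 4).choose (2 * m + 4) : ℚ) - (-540) * ((3 * m + 3).choose (2 * m + 4) : ℚ) - (-2025) * ((3 * m + 2).choose (2 * m + 4) : ℚ) - (-3402) * ((3 * m + 1).choose (2 * m + 4) : ℚ) - (-2187) * ((3 * m).choose (2 * m + 4) : ℚ)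
      - (2 * m + 11) * cnt C (2 * m + 2) ∅ := by
  have hq : (1 + 3 * X : ℚ⟦X⟧) ^ (3 * (m + 1 + 1) - (3 * m) - 1) * (1 - 9 * X)
      = PowerSeries.C (1) * X ^ 0 + PowerSeries.C (6) * X ^ 1 + PowerSeries.C (-45) * X ^ 2 + PowerSeries.C (-540) * X ^ 3 + PowerSeries.C (-2025) * X ^ 4 + PowerSeries.C (-3402) * X ^ 5 + PowerSeries.C (-2187) * X ^ 6 := by
    rw [show 3 * (m + 1 + 1) - (3 * m) - 1 = 5 by omega]
    simp only [map_neg, map_one, map_ofNat]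
    ring
  have h := cnt_min_add_two hF hC (M := m + 1) (k := 3 * m) (by omega) (by omega) (by omega) hmin hq
  simp only [add_mul, map_add] at h
  rw [coeff_C_mul_X_pow_mul_geom _ (by omega), coeff_C_mul_X_pow_mul_geom _ (by omega), coeff_C_mul_X_pow_mul_geom _ (by omega), coeff_C_mul_X_pow_mul_geom _ (by omega), coeff_C_mul_X_pow_mul_geom _ (by omega), coeff_C_mul_X_pow_mul_geom _ (by omega), coeff_C_mul_X_pow_mul_geom _ (by omega)] at h
  rw [show 3 * (m + 1 + 1) - 0 = 3 * m + 6 by omega, show 3 * (m + 1 + 1) - 1 = 3 * m + 5 by omega, show 3 * (m + 1 + 1) - 2 = 3 * m + 4 by omega, show 3 * (m + 1 + 1) - 3 = 3 * m + 3 by omega, show 3 * (m + 1 + 1) - 4 = 3 * m + 2 by omega, show 3 * (m + 1 + 1) - 5 = 3 * m + 1 by omega, show 3 * (m + 1 + 1) - 6 = 3 * m by omega,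
    show 2 * (m + 1 + 1) = 2 * m + 4 by ring, show 2 * (m + 1) = 2 * m + 2 by ring] at h
  simp [coeff_X_pow] at h
  linarith

lemma cnt_min_add_two_six_mul_add_two (hF : Fintype.card F = 4) {C : Submodule F (Fin n → F)}
    (hC : IsTypeIV C) {m : ℕ} (hm : 3 ≤ m) (hn : n = 6 * m + 2) (hmin : IsMinDist C (2 * m + 2)) :
    (cnt C (2 * m + 4) ∅ : ℚ) =
      -(1) * ((3 * m + 6).choose (2 * m + 4) : ℚ) - (3) * ((3 * m + 5).choose (2 * m + 4) : ℚ) - (-54) * ((3 * m + 4).choose (2 * m + 4) : ℚ) - (-378) * ((3 * m + 3).choose (2 * m + 4) : ℚ) - (-891) * ((3 * m + 2).choose (2 * m + 4) : ℚ) - (-729) * ((3 * m + 1).choose (2 * m + 4) : ℚ)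
      - (2 * m + 8) * cnt C (2 * m + 2) ∅ := by
  have hq : (1 + 3 * X : ℚ⟦X⟧) ^ (3 * (m + 1 + 1) - (3 * m + 1) - 1) * (1 - 9 * X)
      = PowerSeries.C (1) * X ^ 0 + PowerSeries.C (3) * X ^ 1 + PowerSeries.C (-54) * X ^ 2 + PowerSeries.C (-378) * X ^ 3 + PowerSeries.C (-891) * X ^ 4 + PowerSeries.C (-729) * X ^ 5 := by
    rw [show 3 * (m + 1 + 1) - (3 * m + 1) - 1 = 4 by omega]
    simp only [map_neg, map_one, map_ofNat]
    ring
  have h := cnt_min_add_two hF hC (M := m + 1) (k := 3 * m + 1) (by omega) (by omega) (by omega) hmin hq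
  simp only [add_mul, map_add] at h
  rw [coeff_C_mul_X_pow_mul_geom _ (by omega), coeff_C_mul_X_pow_mul_geom _ (by omega), coeff_C_mul_X_pow_mul_geom _ (by omega), coeff_C_mul_X_pow_mul_geom _ (by omega), coeff_C_mul_X_pow_mul_geom _ (by omega), coeff_C_mul_X_pow_mul_geom _ (by omega)] at h
  rw [show 3 * (m + 1 + 1) - 0 = 3 * m + 6 by omega, show 3 * (m + 1 + 1) - 1 = 3 * m + 5 by omega, show 3 * (m + 1 + 1) - 2 = 3 * m + 4 by omega, show 3 * (m + 1 + 1) - 3 = 3 * m + 3 by omega, show 3 * (m + 1 + 1) - 4 = 3 * m + 2 by omega, show 3 * (m + 1 + 1) - 5 = 3 * m + 1 by omega,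
    show 2 * (m + 1 + 1) = 2 * m + 4 by ring, show 2 * (m + 1) = 2 * m + 2 by ring] at h
  simp [coeff_X_pow] at h
  linarith

end Formulas

end

/-! ### Upper bounds on m from negativity of a weight count. -/

section

section Nonexistence

variable {F : Type*} [Field F] [Fintype F] {n : ℕ}

lemma choose_succ_ratio (a b : ℕ) (h : b ≤ a + 1) :
    ((a + 1).choose b : ℚ) * (a + 1 - b) = (a.choose b : ℚ) * (a + 1) := by
  have := Nat.choose_mul_succ_eq a b
  have h2 : ((a + 1 - b : ℕ) : ℚ) = a + 1 - b := by rw [Nat.cast_sub h]; push_cast; ring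
  rw [← h2]
  exact_mod_cast this.symm

/-- The binomial coefficients in the formulas for the two lowest weights are polynomial multiples
of a common positive number. -/
lemma exists_choose_eq (k : ℕ) : ∃ z : ℚ, 0 < z ∧
    ((3 * (k + 4)).choose (2 * (k + 4) + 4) : ℚ) =
      z * ((k + 1) * (k + 2) * (k + 3) * (k + 4) * (k + 5) * (k + 6)) ∧
    ((3 * (k + 4) + 1).choose (2 * (k + 4) + 4) : ℚ) =
      z * ((3 * k + 13) * ((k + 2) * (k + 3) * (k + 4) * (k + 5) * (k + 6))) ∧
    ((3 * (k + 4) + 2).choose (2 * (k + 4) + 4) : ℚ) =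
      z * ((3 * k + 13) * (3 * k + 14) * ((k + 3) * (k + 4) * (k + 5) * (k + 6))) ∧
    ((3 * (k + 4) + 3).choose (2 * (k + 4) + 4) : ℚ) =
      z * ((3 * k + 13) * (3 * k + 14) * (3 * k + 15) * ((k + 4) * (k + 5) * (k + 6))) ∧
    ((3 * (k + 4) + 4).choose (2 * (k + 4) + 4) : ℚ) =
      z * ((3 * k + 13) * (3 * k + 14) * (3 * k + 15) * (3 * k + 16) * ((k + 5) * (k + 6))) ∧
    ((3 * (k + 4) + 5).choose (2 * (k + 4) + 4) : ℚ) =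
      z * ((3 * k + 13) * (3 * k + 14) * (3 * k + 15) * (3 * k + 16) * (3 * k + 17) * (k + 6)) ∧
    ((3 * (k + 4) + 6).choose (2 * (k + 4) + 4) : ℚ) =
      z * ((3 * k + 13) * (3 * k + 14) * (3 * k + 15) * (3 * k + 16) * (3 * k + 17) *
        (3 * k + 18)) ∧
    ((3 * (k + 4)).choose (2 * (k + 4) + 2) : ℚ) =
      z * ((2 * k + 12) * (2 * k + 11) * ((k + 3) * (k + 4) * (k + 5) * (k + 6))) ∧
    ((3 * (k + 4) + 1).choose (2 * (k + 4) + 2) : ℚ) =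
      z * ((2 * k + 12) * (2 * k + 11) * (3 * k + 13) * ((k + 4) * (k + 5) * (k + 6))) ∧
    ((3 * (k + 4) + 2).choose (2 * (k + 4) + 2) : ℚ) =
      z * ((2 * k + 12) * (2 * k + 11) * (3 * k + 13) * (3 * k + 14) * ((k + 5) * (k + 6))) ∧
    ((3 * (k + 4) + 3).choose (2 * (k + 4) + 2) : ℚ) =
      z * ((2 * k + 12) * (2 * k + 11) * (3 * k + 13) * (3 * k + 14) * (3 * k + 15) * (k + 6)) := by
  have hpos : (0 : ℚ) < (3 * (k + 4)).choose (2 * (k + 4) + 4) := by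
    exact_mod_cast Nat.choose_pos (by omega)
  have r1 := Nat.choose_succ_right_eq (3 * (k + 4)) (2 * (k + 4) + 3)
  have r2 := Nat.choose_succ_right_eq (3 * (k + 4)) (2 * (k + 4) + 2)
  rw [show 3 * (k + 4) - (2 * (k + 4) + 3) = k + 1 by omega] at r1
  rw [show 3 * (k + 4) - (2 * (k + 4) + 2) = k + 2 by omega] at r2
  have r1' : ((3 * (k + 4)).choose (2 * (k + 4) + 4) : ℚ) * (2 * k + 12)
      = (3 * (k + 4)).choose (2 * (k + 4) + 3) * (k + 1) := by
    have : (((3 * (k + 4)).choose (2 * (k + 4) + 3 + 1) * (2 * (k + 4) + 3 + 1) : ℕ) : ℚ)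
      = ((3 * (k + 4)).choose (2 * (k + 4) + 3) * (k + 1) : ℕ) := by rw [r1]
    push_cast at this
    linear_combination this
  have r2' : ((3 * (k + 4)).choose (2 * (k + 4) + 3) : ℚ) * (2 * k + 11)
      = (3 * (k + 4)).choose (2 * (k + 4) + 2) * (k + 2) := by
    have : (((3 * (k + 4)).choose (2 * (k + 4) + 2 + 1) * (2 * (k + 4) + 2 + 1) : ℕ) : ℚ)
      = ((3 * (k + 4)).choose (2 * (k + 4) + 2) * (k + 2) : ℕ) := by rw [r2]
    push_cast at this
    linear_combination this
  have x0 : ((3 * (k + 4) + 1).choose (2 * (k + 4) + 4) : ℚ) * (k + 1) = (3 * (k + 4)).choose (2 * (k + 4) + 4) * (3 * k + 13) := by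
    have h : ((3 * (k + 4) + 1).choose (2 * (k + 4) + 4) : ℚ) * (((3 * (k + 4)) : ℕ) + 1 - (2 * (k + 4) + 4 : ℕ))
      = (3 * (k + 4)).choose (2 * (k + 4) + 4) * (((3 * (k + 4)) : ℕ) + 1) := choose_succ_ratio _ _ (by omega)
    push_cast at h
    linear_combination h
  have x1 : ((3 * (k + 4) + 2).choose (2 * (k + 4) + 4) : ℚ) * (k + 2) = (3 * (k + 4) + 1).choose (2 * (k + 4) + 4) * (3 * k + 14) := by
    have h : ((3 * (k + 4) + 2).choose (2 * (k + 4) + 4) : ℚ) * (((3 * (k + 4) + 1) : ℕ) + 1 - (2 * (k + 4) + 4 : ℕ))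
      = (3 * (k + 4) + 1).choose (2 * (k + 4) + 4) * (((3 * (k + 4) + 1) : ℕ) + 1) := choose_succ_ratio _ _ (by omega)
    push_cast at h
    linear_combination h
  have x2 : ((3 * (k + 4) + 3).choose (2 * (k + 4) + 4) : ℚ) * (k + 3) = (3 * (k + 4) + 2).choose (2 * (k + 4) + 4) * (3 * k + 15) := by
    have h : ((3 * (k + 4) + 3).choose (2 * (k + 4) + 4) : ℚ) * (((3 * (k + 4) + 2) : ℕ) + 1 - (2 * (k + 4) + 4 : ℕ))
      = (3 * (k + 4) + 2).choose (2 * (k + 4) + 4) * (((3 * (k + 4) + 2) : ℕ) + 1) := choose_succ_ratio _ _ (by omega)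
    push_cast at h
    linear_combination h
  have x3 : ((3 * (k + 4) + 4).choose (2 * (k + 4) + 4) : ℚ) * (k + 4) = (3 * (k + 4) + 3).choose (2 * (k + 4) + 4) * (3 * k + 16) := by
    have h : ((3 * (k + 4) + 4).choose (2 * (k + 4) + 4) : ℚ) * (((3 * (k + 4) + 3) : ℕ) + 1 - (2 * (k + 4) + 4 : ℕ))
      = (3 * (k + 4) + 3).choose (2 * (k + 4) + 4) * (((3 * (k + 4) + 3) : ℕ) + 1) := choose_succ_ratio _ _ (by omega)
    push_cast at h
    linear_combination h
  have x4 : ((3 * (k + 4) + 5).choose (2 * (k + 4) + 4) : ℚ) * (k + 5) = (3 * (k + 4) + 4).choose (2 * (k + 4) + 4) * (3 * k + 17) := by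
    have h : ((3 * (k + 4) + 5).choose (2 * (k + 4) + 4) : ℚ) * (((3 * (k + 4) + 4) : ℕ) + 1 - (2 * (k + 4) + 4 : ℕ))
      = (3 * (k + 4) + 4).choose (2 * (k + 4) + 4) * (((3 * (k + 4) + 4) : ℕ) + 1) := choose_succ_ratio _ _ (by omega)
    push_cast at h
    linear_combination h
  have x5 : ((3 * (k + 4) + 6).choose (2 * (k + 4) + 4) : ℚ) * (k + 6) = (3 * (k + 4) + 5).choose (2 * (k + 4) + 4) * (3 * k + 18) := by
    have h : ((3 * (k + 4) + 6).choose (2 * (k + 4) + 4) : ℚ) * (((3 * (k + 4) + 5) : ℕ) + 1 - (2 * (k + 4) + 4 : ℕ))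
      = (3 * (k + 4) + 5).choose (2 * (k + 4) + 4) * (((3 * (k + 4) + 5) : ℕ) + 1) := choose_succ_ratio _ _ (by omega)
    push_cast at h
    linear_combination h
  have y0 : ((3 * (k + 4) + 1).choose (2 * (k + 4) + 2) : ℚ) * (k + 3) = (3 * (k + 4)).choose (2 * (k + 4) + 2) * (3 * k + 13) := by
    have h : ((3 * (k + 4) + 1).choose (2 * (k + 4) + 2) : ℚ) * (((3 * (k + 4)) : ℕ) + 1 - (2 * (k + 4) + 2 : ℕ))
      = (3 * (k + 4)).choose (2 * (k + 4) + 2) * (((3 * (k + 4)) : ℕ) + 1) := choose_succ_ratio _ _ (by omega)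
    push_cast at h
    linear_combination h
  have y1 : ((3 * (k + 4) + 2).choose (2 * (k + 4) + 2) : ℚ) * (k + 4) = (3 * (k + 4) + 1).choose (2 * (k + 4) + 2) * (3 * k + 14) := by
    have h : ((3 * (k + 4) + 2).choose (2 * (k + 4) + 2) : ℚ) * (((3 * (k + 4) + 1) : ℕ) + 1 - (2 * (k + 4) + 2 : ℕ))
      = (3 * (k + 4) + 1).choose (2 * (k + 4) + 2) * (((3 * (k + 4) + 1) : ℕ) + 1) := choose_succ_ratio _ _ (by omega)
    push_cast at h
    linear_combination h
  have y2 : ((3 * (k + 4) + 3).choose (2 * (k + 4) + 2) : ℚ) * (k + 5) = (3 * (k + 4) + 2).choose (2 * (k + 4) + 2) * (3 * k + 15) := by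
    have h : ((3 * (k + 4) + 3).choose (2 * (k + 4) + 2) : ℚ) * (((3 * (k + 4) + 2) : ℕ) + 1 - (2 * (k + 4) + 2 : ℕ))
      = (3 * (k + 4) + 2).choose (2 * (k + 4) + 2) * (((3 * (k + 4) + 2) : ℕ) + 1) := choose_succ_ratio _ _ (by omega)
    push_cast at h
    linear_combination h
  generalize ((3 * (k + 4)).choose (2 * (k + 4) + 4) : ℚ) = X0 at *
  generalize ((3 * (k + 4) + 1).choose (2 * (k + 4) + 4) : ℚ) = X1 at *
  generalize ((3 * (k + 4) + 2).choose (2 * (k + 4) + 4) : ℚ) = X2 at *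
  generalize ((3 * (k + 4) + 3).choose (2 * (k + 4) + 4) : ℚ) = X3 at *
  generalize ((3 * (k + 4) + 4).choose (2 * (k + 4) + 4) : ℚ) = X4 at *
  generalize ((3 * (k + 4) + 5).choose (2 * (k + 4) + 4) : ℚ) = X5 at *
  generalize ((3 * (k + 4) + 6).choose (2 * (k + 4) + 4) : ℚ) = X6 at *
  generalize ((3 * (k + 4)).choose (2 * (k + 4) + 2) : ℚ) = Y0 at *
  generalize ((3 * (k + 4) + 1).choose (2 * (k + 4) + 2) : ℚ) = Y1 at *
  generalize ((3 * (k + 4) + 2).choose (2 * (k + 4) + 2) : ℚ) = Y2 at *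
  generalize ((3 * (k + 4) + 3).choose (2 * (k + 4) + 2) : ℚ) = Y3 at *
  generalize ((3 * (k + 4)).choose (2 * (k + 4) + 3) : ℚ) = Z at *
  have hk : (0 : ℚ) ≤ k := Nat.cast_nonneg _
  generalize (k : ℚ) = u at *
  have p : ∀ c : ℚ, 0 < c → u + c ≠ 0 := fun c hc => by positivity
  -- Raising the upper index step by step divides successively by u + 1, ..., u + 6; taking all six
  -- out at once makes every binomial a polynomial multiple of z.
  refine ⟨X0 / ((u + 1) * (u + 2) * (u + 3) * (u + 4) * (u + 5) * (u + 6)), by positivity, ?_⟩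
  generalize hz : X0 / ((u + 1) * (u + 2) * (u + 3) * (u + 4) * (u + 5) * (u + 6)) = z
  have e0 : X0 = z * ((u + 1) * (u + 2) * (u + 3) * (u + 4) * (u + 5) * (u + 6)) := by
    rw [← hz, div_mul_cancel₀ _ (by positivity)]
  have e1 : X1 = z * ((3 * u + 13) * ((u + 2) * (u + 3) * (u + 4) * (u + 5) * (u + 6))) :=
    mul_right_cancel₀ (p 1 (by norm_num)) (by rw [x0, e0]; ring)
  have e2 : X2 = z * ((3 * u + 13) * (3 * u + 14) * ((u + 3) * (u + 4) * (u + 5) * (u + 6))) :=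
    mul_right_cancel₀ (p 2 (by norm_num)) (by rw [x1, e1]; ring)
  have e3 : X3 = z * ((3 * u + 13) * (3 * u + 14) * (3 * u + 15) * ((u + 4) * (u + 5) * (u + 6))) :=
    mul_right_cancel₀ (p 3 (by norm_num)) (by rw [x2, e2]; ring)
  have e4 : X4 = z * ((3 * u + 13) * (3 * u + 14) * (3 * u + 15) * (3 * u + 16) * ((u + 5) * (u + 6))) :=
    mul_right_cancel₀ (p 4 (by norm_num)) (by rw [x3, e3]; ring)
  have e5 : X5 = z * ((3 * u + 13) * (3 * u + 14) * (3 * u + 15) * (3 * u + 16) * (3 * u + 17) * (u + 6)) :=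
    mul_right_cancel₀ (p 5 (by norm_num)) (by rw [x4, e4]; ring)
  have e6 : X6 = z * ((3 * u + 13) * (3 * u + 14) * (3 * u + 15) * (3 * u + 16) * (3 * u + 17) * (3 * u + 18)) :=
    mul_right_cancel₀ (p 6 (by norm_num)) (by rw [x5, e5]; ring)
  have hZ : Z = z * ((2 * u + 12) * ((u + 2) * (u + 3) * (u + 4) * (u + 5) * (u + 6))) :=
    mul_right_cancel₀ (p 1 (by norm_num)) (by rw [← r1', e0]; ring)
  have f0 : Y0 = z * ((2 * u + 12) * (2 * u + 11) * ((u + 3) * (u + 4) * (u + 5) * (u + 6))) :=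
    mul_right_cancel₀ (p 2 (by norm_num)) (by rw [← r2', hZ]; ring)
  have f1 : Y1 = z * ((2 * u + 12) * (2 * u + 11) * (3 * u + 13) * ((u + 4) * (u + 5) * (u + 6))) :=
    mul_right_cancel₀ (p 3 (by norm_num)) (by rw [y0, f0]; ring)
  have f2 : Y2 = z * ((2 * u + 12) * (2 * u + 11) * (3 * u + 13) * (3 * u + 14) * ((u + 5) * (u + 6))) :=
    mul_right_cancel₀ (p 4 (by norm_num)) (by rw [y1, f1]; ring)
  have f3 : Y3 = z * ((2 * u + 12) * (2 * u + 11) * (3 * u + 13) * (3 * u + 14) * (3 * u + 15) * ((u + 6))) :=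
    mul_right_cancel₀ (p 5 (by norm_num)) (by rw [y2, f2]; ring)
  exact ⟨e0, e1, e2, e3, e4, e5, e6, f0, f1, f2, f3⟩

/-- From m = 17 on, the formula would make the number of words of weight d + 2 negative. -/
theorem lt_of_isMinDist_six_mul (hF : Fintype.card F = 4) {C : Submodule F (Fin n → F)}
    (hC : IsTypeIV C) {m : ℕ} (hn : n = 6 * m) (hmin : IsMinDist C (2 * m + 2)) : m < 17 := by
  by_contra! hm
  have h1 := cnt_min_six_mul hF hC (by omega) hn hmin
  have h2 := cnt_min_add_two_six_mul hF hC (by omega) hn hmin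
  rw [h1] at h2
  have h3 : (0 : ℚ) ≤ cnt C (2 * m + 4) ∅ := Nat.cast_nonneg _
  rw [h2] at h3
  clear h1 h2 hmin
  obtain ⟨j, rfl⟩ := Nat.exists_eq_add_of_le' hm
  obtain ⟨z, hz, h0, h1, h2, h4, h5, h6, h7, g0, g1, g2, g3⟩ := exists_choose_eq (j + 13)
  rw [show j + 13 + 4 = j + 17 by ring] at h0 h1 h2 h4 h5 h6 h7 g0 g1 g2 g3
  rw [h7, h6, h5, h4, h2, h1, h0, g3, g2, g1, g0] at h3
  push_cast at h3
  clear h0 h1 h2 h4 h5 h6 h7 g0 g1 g2 g3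
  have hu : (0 : ℚ) ≤ j := Nat.cast_nonneg _
  generalize (j : ℚ) = u at *
  -- This is the negative of the count, expanded in u = m - 17; all its coefficients are positive.
  have hneg : (0 : ℚ) < z * (13952204640 + 50046874272 * u ^ 1 + 16465085496 * u ^ 2 + 2343505392 * u ^ 3 + 179574120 * u ^ 4 + 7766928 * u ^ 5 + 179424 * u ^ 6 + 1728 * u ^ 7) := by positivity
  refine absurd h3 (not_le.2 ?_)
  rw [← neg_pos]
  refine hneg.trans_eq ?_
  ring

theorem lt_of_isMinDist_six_mul_add_two (hF : Fintype.card F = 4) {C : Submodule F (Fin n → F)}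
    (hC : IsTypeIV C) {m : ℕ} (hn : n = 6 * m + 2) (hmin : IsMinDist C (2 * m + 2)) : m < 20 := by
  by_contra! hm
  have h1 := cnt_min_six_mul_add_two hF hC (by omega) hn hmin
  have h2 := cnt_min_add_two_six_mul_add_two hF hC (by omega) hn hmin
  rw [h1] at h2
  have h3 : (0 : ℚ) ≤ cnt C (2 * m + 4) ∅ := Nat.cast_nonneg _
  rw [h2] at h3
  clear h1 h2 hmin
  obtain ⟨j, rfl⟩ := Nat.exists_eq_add_of_le' hm
  obtain ⟨z, hz, h0, h1, h2, h4, h5, h6, h7, g0, g1, g2, g3⟩ := exists_choose_eq (j + 16)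
  rw [show j + 16 + 4 = j + 20 by ring] at h0 h1 h2 h4 h5 h6 h7 g0 g1 g2 g3
  rw [h7, h6, h5, h4, h2, h1, g3, g2, g1] at h3
  push_cast at h3
  clear h0 h1 h2 h4 h5 h6 h7 g0 g1 g2 g3
  have hu : (0 : ℚ) ≤ j := Nat.cast_nonneg _
  generalize (j : ℚ) = u at *
  have hneg : (0 : ℚ) < z * (44193885120 + 77797112976 * u ^ 1 + 20536964376 * u ^ 2 + 2411198232 * u ^ 3 + 153640488 * u ^ 4 + 5545848 * u ^ 5 + 107136 * u ^ 6 + 864 * u ^ 7) := by positivity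
  refine absurd h3 (not_le.2 ?_)
  rw [← neg_pos]
  refine hneg.trans_eq ?_
  ring

end Nonexistence

end

/-! ### Divisibility obstructions to regularity in the minimum weight. -/

section

section Integrality

variable {F : Type*} [Field F] [Fintype F] {n : ℕ}

lemma supp_smul {F : Type*} [Field F] {u : F} (hu : u ≠ 0) (x : Fin n → F) :
    supp (u • x) = supp x := by
  ext i
  simp [supp, hu]

lemma hammingNorm_smul_eq {F : Type*} [Field F] {u : F} (hu : u ≠ 0) (x : Fin n → F) :
    hammingNorm (u • x) = hammingNorm x := by
  rw [← card_supp, ← card_supp, supp_smul hu]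

/-- Every codeword through `p` has exactly one scalar multiple with entry `1` at `p`. -/
lemma cnt_eq_three_mul (hF : Fintype.card F = 4) (C : Submodule F (Fin n → F)) (w : ℕ)
    {T : Finset (Fin n)} {p : Fin n} (hp : p ∈ T) :
    cnt C w T = 3 * #{x : Fin n → F | (x ∈ C ∧ hammingNorm x = w ∧ T ⊆ supp x) ∧ x p = 1} := by
  rw [cnt, Finset.card_eq_sum_card_fiberwise (f := fun x => x p) (t := univ.erase (0 : F))]
  · rw [Finset.sum_congr rfl (g := fun _ =>
      #{x : Fin n → F | (x ∈ C ∧ hammingNorm x = w ∧ T ⊆ supp x) ∧ x p = 1}), Finset.sum_const,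
      card_erase_of_mem (mem_univ _), card_univ, hF, smul_eq_mul]
    intro u hu
    have hu0 : u ≠ 0 := (mem_erase.1 hu).1
    rw [Finset.filter_filter]
    refine Finset.card_bij' (fun x _ => u⁻¹ • x) (fun x _ => u • x) ?_ ?_ ?_ ?_
    · intro x hx
      simp only [mem_filter, mem_univ, true_and] at hx ⊢
      obtain ⟨⟨h1, h2, h3⟩, h4⟩ := hx
      refine ⟨⟨C.smul_mem _ h1, ?_, ?_⟩, ?_⟩
      · rw [hammingNorm_smul_eq (inv_ne_zero hu0), h2]
      · rwa [supp_smul (inv_ne_zero hu0)]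
      · simp [h4, hu0]
    · intro x hx
      simp only [mem_filter, mem_univ, true_and] at hx ⊢
      obtain ⟨⟨h1, h2, h3⟩, h4⟩ := hx
      refine ⟨⟨C.smul_mem _ h1, ?_, ?_⟩, ?_⟩
      · rw [hammingNorm_smul_eq hu0, h2]
      · rwa [supp_smul hu0]
      · simp [h4]
    · intro x _; simp [smul_smul, hu0]
    · intro x _; simp [smul_smul, hu0]
  · intro x hx
    have := (mem_filter.1 hx).2.2.2 hp
    simpa [supp] using this

/-- The common number of words through a t-set is the quotient of w.choose t * A by n.choose t, and
it must be a multiple of 3 because nonzero scalars act freely on these words. -/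
lemma not_regular_of_not_dvd (hF : Fintype.card F = 4) {C : Submodule F (Fin n → F)} {w t A : ℕ}
    (hA : cnt C w ∅ = A) (ht : 0 < t) (htn : t ≤ n)
    (h : ¬ 3 * n.choose t ∣ w.choose t * A) : ¬ Regular C w t := by
  intro hr
  obtain ⟨T, -, hT⟩ := Finset.exists_subset_card_eq (s := (univ : Finset (Fin n))) (n := t) (by simpa)
  obtain ⟨p, hp⟩ := Finset.card_pos.1 (hT ▸ ht)
  have h1 := hr.choose_mul hT
  rw [cnt_eq_three_mul hF C w hp, hA, mul_left_comm] at h1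
  exact h ⟨_, by rw [← h1, mul_assoc]⟩

lemma cnt_min_six_mul_nat (hF : Fintype.card F = 4) {C : Submodule F (Fin n → F)}
    (hC : IsTypeIV C) {m : ℕ} (hm : 2 ≤ m) (hn : n = 6 * m) (hmin : IsMinDist C (2 * m + 2)) :
    cnt C (2 * m + 2) ∅ = 3 * (3 * m + 2).choose (2 * m + 2) + 45 * (3 * m + 1).choose (2 * m + 2)
      + 81 * (3 * m).choose (2 * m + 2) - (3 * m + 3).choose (2 * m + 2) := by
  have h := cnt_min_six_mul hF hC hm hn hmin
  have h' : cnt C (2 * m + 2) ∅ + (3 * m + 3).choose (2 * m + 2) =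
      3 * (3 * m + 2).choose (2 * m + 2) + 45 * (3 * m + 1).choose (2 * m + 2)
      + 81 * (3 * m).choose (2 * m + 2) := by
    rw [← Nat.cast_inj (R := ℚ)]
    push_cast
    linarith
  omega

lemma cnt_min_six_mul_add_two_nat (hF : Fintype.card F = 4) {C : Submodule F (Fin n → F)}
    (hC : IsTypeIV C) {m : ℕ} (hm : 1 ≤ m) (hn : n = 6 * m + 2) (hmin : IsMinDist C (2 * m + 2)) :
    cnt C (2 * m + 2) ∅ = 6 * (3 * m + 2).choose (2 * m + 2) + 27 * (3 * m + 1).choose (2 * m + 2)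
      - (3 * m + 3).choose (2 * m + 2) := by
  have h := cnt_min_six_mul_add_two hF hC hm hn hmin
  have h' : cnt C (2 * m + 2) ∅ + (3 * m + 3).choose (2 * m + 2) =
      6 * (3 * m + 2).choose (2 * m + 2) + 27 * (3 * m + 1).choose (2 * m + 2) := by
    rw [← Nat.cast_inj (R := ℚ)]
    push_cast
    linarith
  omega

lemma cnt_min_six_mul_add_four_nat (hF : Fintype.card F = 4) {C : Submodule F (Fin n → F)}
    (hC : IsTypeIV C) {m : ℕ} (hm : 1 ≤ m) (hn : n = 6 * m + 4) (hmin : IsMinDist C (2 * m + 2)) :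
    cnt C (2 * m + 2) ∅ = 9 * (3 * m + 2).choose (2 * m + 2) - (3 * m + 3).choose (2 * m + 2) := by
  have h := cnt_min_six_mul_add_four hF hC hm hn hmin
  have h' : cnt C (2 * m + 2) ∅ + (3 * m + 3).choose (2 * m + 2) =
      9 * (3 * m + 2).choose (2 * m + 2) := by
    rw [← Nat.cast_inj (R := ℚ)]
    push_cast
    linarith
  omega

/-- Size 6 is the first with r = 0 for this length, and size 8, tested for m = 10 and 15, has r = 2.
The list stops at 16 because of `lt_of_isMinDist_six_mul`. -/
lemma not_regular_six_mul (hF : Fintype.card F = 4) {C : Submodule F (Fin n → F)}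
    (hC : IsTypeIV C) {m : ℕ} (hn : n = 6 * m) (hmin : IsMinDist C (2 * m + 2)) {t : ℕ}
    (h : (m, t) ∈ [(3, 6), (4, 6), (5, 6), (6, 6), (7, 6), (8, 6), (9, 6), (11, 6), (12, 6), (13, 6),
      (14, 6), (16, 6), (10, 8), (15, 8)]) : ¬ Regular C (2 * m + 2) t := by
  have key : ∀ q ∈ [(3, 6), (4, 6), (5, 6), (6, 6), (7, 6), (8, 6), (9, 6), (11, 6), (12, 6), (13, 6),
      (14, 6), (16, 6), (10, 8), (15, 8)], 2 ≤ q.1 ∧ 0 < q.2 ∧ q.2 ≤ 6 * q.1 ∧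
      ¬ 3 * (6 * q.1).choose q.2 ∣ (2 * q.1 + 2).choose q.2 *
        (3 * (3 * q.1 + 2).choose (2 * q.1 + 2) + 45 * (3 * q.1 + 1).choose (2 * q.1 + 2)
          + 81 * (3 * q.1).choose (2 * q.1 + 2) - (3 * q.1 + 3).choose (2 * q.1 + 2)) := by
    simp only [Nat.choose_eq_descFactorial_div_factorial]
    decide +kernel
  obtain ⟨h1, h2, h3, h4⟩ := key _ h
  exact not_regular_of_not_dvd hF (cnt_min_six_mul_nat hF hC h1 hn hmin) h2 (hn ▸ h3)
    (by rw [hn]; exact h4)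

lemma not_regular_six_mul_add_two (hF : Fintype.card F = 4) {C : Submodule F (Fin n → F)}
    (hC : IsTypeIV C) {m : ℕ} (hn : n = 6 * m + 2) (hmin : IsMinDist C (2 * m + 2)) {t : ℕ}
    (h : (m, t) ∈ [(1, 4), (2, 4), (3, 4), (4, 4), (5, 4), (6, 4), (7, 4), (8, 4), (9, 4), (10, 4),
      (12, 4), (13, 4), (14, 4), (15, 4), (16, 4), (17, 4), (18, 4), (19, 4), (11, 8)]) :
    ¬ Regular C (2 * m + 2) t := by
  have key : ∀ q ∈ [(1, 4), (2, 4), (3, 4), (4, 4), (5, 4), (6, 4), (7, 4), (8, 4), (9, 4), (10, 4),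
      (12, 4), (13, 4), (14, 4), (15, 4), (16, 4), (17, 4), (18, 4), (19, 4), (11, 8)],
      1 ≤ q.1 ∧ 0 < q.2 ∧ q.2 ≤ 6 * q.1 + 2 ∧
      ¬ 3 * (6 * q.1 + 2).choose q.2 ∣ (2 * q.1 + 2).choose q.2 *
        (6 * (3 * q.1 + 2).choose (2 * q.1 + 2) + 27 * (3 * q.1 + 1).choose (2 * q.1 + 2)
          - (3 * q.1 + 3).choose (2 * q.1 + 2)) := by
    simp only [Nat.choose_eq_descFactorial_div_factorial]
    decide +kernel
  obtain ⟨h1, h2, h3, h4⟩ := key _ h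
  exact not_regular_of_not_dvd hF (cnt_min_six_mul_add_two_nat hF hC h1 hn hmin) h2 (hn ▸ h3)
    (by rw [hn]; exact h4)

lemma not_regular_six_mul_add_four (hF : Fintype.card F = 4) {C : Submodule F (Fin n → F)}
    (hC : IsTypeIV C) {m : ℕ} (hn : n = 6 * m + 4) (hmin : IsMinDist C (2 * m + 2)) {t : ℕ}
    (h : (m, t) ∈ [(1, 2), (4, 2), (13, 2), (3, 4), (5, 4), (6, 4), (7, 4), (8, 4), (10, 4), (11, 4),
      (12, 4), (15, 4), (16, 4), (17, 4), (18, 4), (20, 4), (21, 4), (9, 5), (14, 6), (19, 6)]) :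
    ¬ Regular C (2 * m + 2) t := by
  have key : ∀ q ∈ [(1, 2), (4, 2), (13, 2), (3, 4), (5, 4), (6, 4), (7, 4), (8, 4), (10, 4), (11, 4),
      (12, 4), (15, 4), (16, 4), (17, 4), (18, 4), (20, 4), (21, 4), (9, 5), (14, 6), (19, 6)],
      1 ≤ q.1 ∧ 0 < q.2 ∧ q.2 ≤ 6 * q.1 + 4 ∧
      ¬ 3 * (6 * q.1 + 4).choose q.2 ∣ (2 * q.1 + 2).choose q.2 *
        (9 * (3 * q.1 + 2).choose (2 * q.1 + 2) - (3 * q.1 + 3).choose (2 * q.1 + 2)) := by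
    simp only [Nat.choose_eq_descFactorial_div_factorial]
    decide +kernel
  obtain ⟨h1, h2, h3, h4⟩ := key _ h
  exact not_regular_of_not_dvd hF (cnt_min_six_mul_add_four_nat hF hC h1 hn hmin) h2 (hn ▸ h3)
    (by rw [hn]; exact h4)

end Integrality

end

/-! ### Length 16: excluding a 3-design of minimum weight words. -/

section

section LengthSixteen

variable {F : Type*} [Field F] [Fintype F] {n : ℕ}

lemma sum_choose_inter (C : Submodule F (Fin n → F)) (w : ℕ) (B : Finset (Fin n)) (k : ℕ) :
    ∑ y : Fin n → F with y ∈ C ∧ hammingNorm y = w, (#(supp y ∩ B)).choose k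
      = ∑ T ∈ B.powersetCard k, cnt C w T := by
  simp only [cnt, Finset.card_filter]
  rw [Finset.sum_comm, Finset.sum_filter]
  refine Finset.sum_congr rfl fun y _ => ?_
  split_ifs with h
  · simp only [h.1, h.2, true_and]
    rw [← Finset.card_filter, ← Finset.card_powersetCard]
    congr 1
    ext T
    simp only [mem_powersetCard, mem_filter, subset_inter_iff]
    tauto
  · refine (Finset.sum_eq_zero fun T _ => if_neg fun h' => h ⟨h'.1, h'.2.1⟩).symm

lemma sum_choose_inter_of_regular {C : Submodule F (Fin n → F)} {w k c : ℕ}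
    (h : ∀ T : Finset (Fin n), #T = k → cnt C w T = c) (B : Finset (Fin n)) :
    ∑ y : Fin n → F with y ∈ C ∧ hammingNorm y = w, (#(supp y ∩ B)).choose k
      = (#B).choose k * c := by
  rw [sum_choose_inter, Finset.sum_congr rfl fun T hT => h T (mem_powersetCard.1 hT).2, sum_const,
    card_powersetCard, smul_eq_mul]

/-- This cubic is nonnegative at every natural number and vanishes exactly at 0, 2 and 3, so a sum
of its values can single out these intersection sizes. -/
lemma choose_combination (i : ℕ) :
    (6 * i.choose 3 + 2 * i.choose 1 - 4 * i.choose 2 : ℤ) = i * (i - 2) * (i - 3) := by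
  have h2 := Nat.choose_succ_right_eq i 1
  have h3 := Nat.choose_succ_right_eq i 2
  rw [Nat.choose_one_right] at h2 ⊢
  rcases i with _ | _ | i
  · simp
  · simp [Nat.choose]
  · have h2' : ((i + 2).choose 2 : ℤ) * 2 = (i + 2) * (i + 1) := by
      have : (i + 2).choose 2 * 2 = (i + 2) * (i + 1) := h2
      exact_mod_cast this
    have h3' : ((i + 2).choose 3 : ℤ) * 3 = (i + 2).choose 2 * i := by
      have : (i + 2).choose 3 * 3 = (i + 2).choose 2 * i := h3
      exact_mod_cast this
    push_cast
    linear_combination 2 * h3' + (i - 2) * h2'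

lemma choose_combination_nonneg (i : ℕ) : (0 : ℤ) ≤ i * (i - 2) * (i - 3) := by
  rcases i with _ | _ | _ | i
  · simp
  · simp
  · simp
  · push_cast
    have : (0 : ℤ) ≤ i := Int.natCast_nonneg i
    have e : ((i : ℤ) + 1 + 1 + 1) * (i + 1 + 1 + 1 - 2) * (i + 1 + 1 + 1 - 3)
      = (i + 3) * (i + 1) * i := by ring
    rw [e]
    positivity

variable {C : Submodule F (Fin 16 → F)}

/-- In a `3`-design of minimum weight words of length 16, distinct blocks meet in 0, 2 or 3
points. -/
lemma inter_of_three_design (hF : Fintype.card F = 4)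
    (h1 : ∀ T : Finset (Fin 16), #T = 1 → cnt C 6 T = 63)
    (h2 : ∀ T : Finset (Fin 16), #T = 2 → cnt C 6 T = 21)
    (h3 : ∀ T : Finset (Fin 16), #T = 3 → cnt C 6 T = 6)
    {x y : Fin 16 → F} (hx : x ∈ C) (hxw : hammingNorm x = 6) (hy : y ∈ C)
    (hyw : hammingNorm y = 6) (hxy : ∀ u : F, y ≠ u • x) :
    #(supp y ∩ supp x) = 0 ∨ #(supp y ∩ supp x) = 2 ∨ #(supp y ∩ supp x) = 3 := by
  set S : Finset (Fin 16 → F) := {y : Fin 16 → F | y ∈ C ∧ hammingNorm y = 6} with hS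
  set f : (Fin 16 → F) → ℤ := fun y =>
    (#(supp y ∩ supp x) : ℤ) * (#(supp y ∩ supp x) - 2) * (#(supp y ∩ supp x) - 3) with hf
  have hB : #(supp x) = 6 := by rw [card_supp, hxw]
  have e1 := sum_choose_inter_of_regular h1 (supp x)
  have e2 := sum_choose_inter_of_regular h2 (supp x)
  have e3 := sum_choose_inter_of_regular h3 (supp x)
  rw [hB, ← hS] at e1 e2 e3
  have c2 : Nat.choose 6 2 = 15 := by decide
  have c3 : Nat.choose 6 3 = 20 := by decide
  rw [c2] at e2
  rw [c3] at e3
  rw [Nat.choose_one_right] at e1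
  -- Here 216 = 6·20·6 + 2·6·63 - 4·15·21. The three multiples of x already contribute 3·(6·4·3) =
  -- 216, so every other word contributes zero.
  have htot : ∑ y ∈ S, f y = 216 := by
    simp only [hf, ← choose_combination]
    rw [Finset.sum_sub_distrib, Finset.sum_add_distrib, ← Finset.mul_sum, ← Finset.mul_sum,
      ← Finset.mul_sum, ← Nat.cast_sum, ← Nat.cast_sum, ← Nat.cast_sum, e1, e2, e3]
    norm_num
  have hx0 : x ≠ 0 := by rintro rfl; simp at hxw
  set R : Finset (Fin 16 → F) := (univ.erase (0 : F)).image fun u => u • x with hR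
  have hRS : R ⊆ S := by
    intro z hz
    obtain ⟨u, hu, rfl⟩ := mem_image.1 hz
    have hu0 := (mem_erase.1 hu).1
    rw [hS, mem_filter]
    exact ⟨mem_univ _, C.smul_mem _ hx, by rw [hammingNorm_smul_eq hu0, hxw]⟩
  have hRsum : ∑ y ∈ R, f y = 216 := by
    rw [hR, Finset.sum_image]
    · rw [Finset.sum_congr rfl (g := fun _ => (72 : ℤ))]
      · rw [sum_const, card_erase_of_mem (mem_univ _), card_univ, hF]
        norm_num
      · intro u hu
        simp only [hf, supp_smul (mem_erase.1 hu).1, inter_self, hB]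
        norm_num
    · intro u _ v _ huv
      exact smul_left_injective F hx0 huv
  have hrest : ∑ y ∈ S \ R, f y = 0 := by
    have := Finset.sum_sdiff (f := f) hRS
    linarith
  have hyR : y ∈ S \ R := by
    rw [mem_sdiff, hS, mem_filter]
    refine ⟨⟨mem_univ _, hy, hyw⟩, fun h => ?_⟩
    obtain ⟨u, -, hu⟩ := mem_image.1 h
    exact hxy u hu.symm
  have hfy : (#(supp y ∩ supp x) : ℤ) * (#(supp y ∩ supp x) - 2) * (#(supp y ∩ supp x) - 3) = 0 :=
    (Finset.sum_eq_zero_iff_of_nonneg fun z _ => choose_combination_nonneg _).1 hrest y hyR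
  rcases mul_eq_zero.1 hfy with h | h
  · rcases mul_eq_zero.1 h with h | h <;> omega
  · omega

/-- Among the seven blocks through two points p and q, normalized to have entry 1 at p, those with a
given entry at q form classes of size 3, and 3 does not divide 7. -/
lemma not_three_design (hF : Fintype.card F = 4) (hC : (C : Set (Fin 16 → F)) = hermitianDual C)
    (h1 : ∀ T : Finset (Fin 16), #T = 1 → cnt C 6 T = 63)
    (h2 : ∀ T : Finset (Fin 16), #T = 2 → cnt C 6 T = 21)
    (h3 : ∀ T : Finset (Fin 16), #T = 3 → cnt C 6 T = 6) : False := by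
  set p : Fin 16 := 0
  set q : Fin 16 := 1
  have hpq : p ≠ q := by decide
  set S : Finset (Fin 16 → F) :=
    {x : Fin 16 → F | (x ∈ C ∧ hammingNorm x = 6 ∧ {p, q} ⊆ supp x) ∧ x p = 1} with hS
  have hScard : #S = 7 := by
    have := cnt_eq_three_mul hF C 6 (T := {p, q}) (p := p) (by simp)
    rw [h2 _ (card_pair hpq), ← hS] at this
    omega
  have hmem : ∀ x, x ∈ S ↔ (x ∈ C ∧ hammingNorm x = 6 ∧ {p, q} ⊆ supp x) ∧ x p = 1 := by
    intro x; simp [hS]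
  have hc2 := two_eq_zero hF
  have hne : ∀ (x : Fin 16 → F) (i : Fin 16), i ∈ supp x ↔ x i ≠ 0 := by intro x i; simp [supp]
  have hcube : ∀ u : F, u ≠ 0 → u ^ 3 = 1 := by
    intro u hu
    have h4 := pow_four hF u
    have : u * (u ^ 3 - 1) = 0 := by linear_combination h4
    exact sub_eq_zero.1 ((mul_eq_zero.1 this).resolve_left hu)
  -- Distinct words of S share two or three points. If their entries at q agree, the contributions
  -- of p and q to the inner product cancel in characteristic 2, which rules out a third common
  -- point; otherwise they do not cancel and a third point is needed.
  have hpair : ∀ x ∈ S, ∀ y ∈ S, y ≠ x →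
      #(supp y ∩ (supp x \ {p, q})) = if y q = x q then 0 else 1 := by
    intro x hx y hy hyx
    obtain ⟨⟨hxC, hxw, hxs⟩, hxp⟩ := (hmem x).1 hx
    obtain ⟨⟨hyC, hyw, hys⟩, hyp⟩ := (hmem y).1 hy
    have hne' : ∀ u : F, y ≠ u • x := by
      intro u hu
      have : u = 1 := by
        have h := congrFun hu p
        rw [Pi.smul_apply, hxp, hyp, smul_eq_mul, mul_one] at h
        exact h.symm
      rw [this, one_smul] at hu
      exact hyx hu
    have hint := inter_of_three_design hF h1 h2 h3 hxC hxw hyC hyw hne'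
    have hsub : ({p, q} : Finset (Fin 16)) ⊆ supp y ∩ supp x := subset_inter hys hxs
    have hdec : supp y ∩ (supp x \ {p, q}) = (supp y ∩ supp x) \ {p, q} := by
      rw [inter_sdiff_assoc]
    have hcard : #(supp y ∩ (supp x \ {p, q})) = #(supp y ∩ supp x) - 2 := by
      rw [hdec, card_sdiff_of_subset hsub, card_pair hpq]
    have hle := card_le_card hsub
    rw [card_pair hpq] at hle
    have hinner : hermitianInner x y = 0 := by
      have : y ∈ hermitianDual C := hC ▸ hyC
      exact this x hxC
    have hsum : hermitianInner x y
        = 1 + x q * y q ^ 2 + ∑ i ∈ supp y ∩ (supp x \ {p, q}), x i * y i ^ 2 := by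
      rw [hermitianInner, ← Finset.sum_subset (subset_univ (supp y ∩ supp x)),
        ← Finset.sum_sdiff hsub, ← hdec, sum_pair hpq, hxp, hyp]
      · ring
      · intro i _ hi
        rw [mem_inter, hne, hne, not_and_or, not_not, not_not] at hi
        rcases hi with h | h <;> simp [h]
    have hyq : y q ≠ 0 := (hne y q).1 (hys (by simp))
    rw [hsum] at hinner
    split_ifs with heq
    · by_contra hc
      have h1c : #(supp y ∩ (supp x \ {p, q})) = 1 := by omega
      obtain ⟨r, hr⟩ := card_eq_one.1 h1c
      have hrm : r ∈ supp y ∩ (supp x \ {p, q}) := by rw [hr]; simp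
      rw [mem_inter, mem_sdiff, hne, hne] at hrm
      rw [hr, sum_singleton, ← heq] at hinner
      have : x r * y r ^ 2 = 0 := by linear_combination hinner - hcube _ hyq - hc2
      exact (mul_ne_zero hrm.2.1 (pow_ne_zero 2 hrm.1)) this
    · by_contra hc
      have h0c : #(supp y ∩ (supp x \ {p, q})) = 0 := by omega
      rw [card_eq_zero.1 h0c, sum_empty] at hinner
      apply heq
      linear_combination (-y q) * hinner + x q * hcube _ hyq + y q * hc2
  have hclass : ∀ x ∈ S, #{y ∈ S | y q = x q} = 3 := by
    intro x hx
    obtain ⟨⟨hxC, hxw, hxs⟩, hxp⟩ := (hmem x).1 hx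
    have hD : #(supp x \ {p, q}) = 4 := by
      rw [card_sdiff_of_subset hxs, card_supp, hxw, card_pair hpq]
    -- Each of the four remaining points of x lies on 6/3 = 2 words of S. The word x itself accounts
    -- for 4 of the 8 incidences, so exactly four words differ from x at q and three agree.
    have hdc : ∑ y ∈ S, #(supp y ∩ (supp x \ {p, q})) = 8 := by
      have hr : ∀ r ∈ supp x \ {p, q}, #{y ∈ S | r ∈ supp y} = 2 := by
        intro r hr
        have hrpq : r ∉ ({p, q} : Finset (Fin 16)) := (mem_sdiff.1 hr).2
        have hT : #(insert r {p, q} : Finset (Fin 16)) = 3 := by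
          rw [card_insert_of_notMem hrpq, card_pair hpq]
        have h := cnt_eq_three_mul hF C 6 (T := insert r {p, q}) (p := p) (by simp)
        rw [h3 _ hT] at h
        have heq : {y ∈ S | r ∈ supp y} = ({x : Fin 16 → F |
            (x ∈ C ∧ hammingNorm x = 6 ∧ insert r {p, q} ⊆ supp x) ∧ x p = 1} : Finset _) := by
          ext y
          simp only [mem_filter, hmem, mem_univ, true_and, insert_subset_iff (a := r)]
          tauto
        rw [heq]
        omega
      have hcomm := Finset.sum_card_bipartiteAbove_eq_sum_card_bipartiteBelow
        (s := S) (t := supp x \ {p, q}) (fun (y : Fin 16 → F) (r : Fin 16) => r ∈ supp y)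
      have e1 : ∀ y, #(supp y ∩ (supp x \ {p, q}))
          = #((supp x \ {p, q}).bipartiteAbove (fun (y : Fin 16 → F) (r : Fin 16) => r ∈ supp y) y) := by
        intro y
        congr 1
        ext i
        simp only [bipartiteAbove, mem_inter, mem_filter]
        tauto
      simp only [e1]
      rw [hcomm, Finset.sum_congr rfl (g := fun _ => 2), sum_const, hD]
      · rfl
      · intro r hr'
        rw [← hr r hr']
        rfl
    rw [← Finset.add_sum_erase S _ hx] at hdc
    have hself : #(supp x ∩ (supp x \ {p, q})) = 4 := by
      rw [inter_eq_right.2 sdiff_subset, hD]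
    rw [hself, Finset.sum_congr rfl (fun y hy => hpair x hx y (mem_of_mem_erase hy) (ne_of_mem_erase hy))] at hdc
    have hcount : ∑ y ∈ S.erase x, (if y q = x q then 0 else 1) = #{y ∈ S | ¬ y q = x q} := by
      rw [Finset.card_filter, ← Finset.add_sum_erase S _ hx, if_neg (not_not.2 rfl), zero_add]
      refine Finset.sum_congr rfl fun y _ => ?_
      split_ifs <;> rfl
    rw [hcount] at hdc
    have := Finset.card_filter_add_card_filter_not (s := S) (fun y => y q = x q)
    omega
  have hdiv : 3 ∣ #S := by
    rw [Finset.card_eq_sum_card_image (fun y : Fin 16 → F => y q) S]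
    refine Finset.dvd_sum fun u hu => ?_
    obtain ⟨x, hx, rfl⟩ := mem_image.1 hu
    rw [hclass x hx]
  rw [hScard] at hdiv
  omega

theorem not_regular_sixteen (hF : Fintype.card F = 4) (hC : IsTypeIV C) (hmin : IsMinDist C 6) :
    ¬ Regular C 6 2 := by
  intro h2
  have hr1 : ∀ w, ∀ j < 2, Regular C w j := fun w j hj =>
    regular_of_le hF hC hmin (t := 2) (by norm_num) (by norm_num) w j hj
  have hr2 := regular_succ hF hC hmin (by decide) (by decide) (t := 2) (r := 0) (by norm_num)
    (by norm_num) (by norm_num) (Or.inl rfl) hr1 h2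
  have h3 : Regular C 6 3 := by
    refine regular_of_add_eq hF hC hmin (by decide) (by norm_num) (by norm_num) (fun w j hj => ?_)
      (by norm_num) (by decide) 6
    rcases Nat.lt_succ_iff_lt_or_eq.1 hj with hj | rfl
    · exact hr1 w j hj
    · exact hr2 w
  have hA : cnt C 6 ∅ = 168 := by
    have := cnt_min_six_mul_add_four_nat hF hC (m := 2) (by norm_num) (by norm_num) hmin
    rw [this]
    decide
  have key : ∀ t c, Regular C 6 t → Nat.choose 6 t * 168 = Nat.choose 16 t * c →
      0 < Nat.choose 16 t → ∀ T : Finset (Fin 16), #T = t → cnt C 6 T = c := by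
    intro t c hr he hp T hT
    have := hr.choose_mul hT
    rw [hA, he] at this
    exact Nat.eq_of_mul_eq_mul_left hp this
  exact not_three_design hF hC.1 (key 1 63 (hr1 6 1 (by norm_num)) (by decide) (by decide))
    (key 2 21 h2 (by decide) (by decide)) (key 3 6 h3 (by decide) (by decide))

end LengthSixteen

end

end TypeIV

end

/-! ### The three residue classes of the length. -/

theorem theorem1p2 {F : Type*} [Field F] [Fintype F] (hF : Fintype.card F = 4)
    (n : ℕ) (C : Submodule F (Fin n → F)) (hC : TypeIV.IsExtremalTypeIV C)
    (m : ℕ) (hm : 1 ≤ m) :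
    (n = 6 * m → m ≠ 1 → m ≠ 2 →
      (m ∉ ({10, 15} : Set ℕ) → TypeIV.DeltaSEq C 5) ∧
      (m ∈ ({10, 15} : Set ℕ) → TypeIV.DeltaSEq C 5 ∨ TypeIV.DeltaSEq C 7)) ∧
    (n = 6 * m + 2 →
      (m ≠ 11 → TypeIV.DeltaSEq C 3) ∧
      (m = 11 → TypeIV.DeltaSEq C 3 ∨ TypeIV.DeltaSEq C 5 ∨ TypeIV.DeltaSEq C 6 ∨
        TypeIV.DeltaSEq C 7)) ∧
    (n = 6 * m + 4 →
      (m ∈ ({1, 2, 4, 13} : Set ℕ) → TypeIV.DeltaSEq C 1) ∧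
      (m ∈ ({3, 5, 6, 7, 8, 10, 11, 12, 15, 16, 17, 18, 20, 21} : Set ℕ) →
        TypeIV.DeltaSEq C 1 ∨ TypeIV.DeltaSEq C 3) ∧
      (m = 9 → TypeIV.DeltaSEq C 1 ∨ TypeIV.DeltaSEq C 3 ∨ TypeIV.DeltaSEq C 4) ∧
      (m ∈ ({14, 19} : Set ℕ) → TypeIV.DeltaSEq C 1 ∨ TypeIV.DeltaSEq C 3 ∨
        TypeIV.DeltaSEq C 4 ∨ TypeIV.DeltaSEq C 5)) := by
  obtain ⟨hIV, hmin⟩ := hC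
  simp only [Set.mem_insert_iff, Set.mem_singleton_iff]
  refine ⟨fun hn h1 h2 => ?_, fun hn => ?_, fun hn => ?_⟩
  · rw [show 2 * (n / 6) + 2 = 2 * m + 2 by omega] at hmin
    -- The starting value is t = 3d - n - 1 with d = 2m + 2, which is 5 here and 3 and 1 for the
    -- other two lengths.
    obtain ⟨l0, l2, -, -⟩ := TypeIV.deltaSEq_ladder hF hIV hmin ⟨m + 1, by ring⟩
      ⟨3 * m, by omega⟩ (t := 5) (by omega)
    have hlt := TypeIV.lt_of_isMinDist_six_mul hF hIV hn hmin
    refine ⟨fun h => ?_, fun h => ?_⟩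
    · refine l0 (by omega) (by omega) (TypeIV.not_regular_six_mul hF hIV hn hmin ?_)
      have : 3 ≤ m := by omega
      interval_cases m <;> simp_all
    · refine l2 (by omega) (by omega) (TypeIV.not_regular_six_mul hF hIV hn hmin ?_)
      rcases h with rfl | rfl <;> simp
  · rw [show 2 * (n / 6) + 2 = 2 * m + 2 by omega] at hmin
    obtain ⟨l0, -, -, l4⟩ := TypeIV.deltaSEq_ladder hF hIV hmin ⟨m + 1, by ring⟩
      ⟨3 * m + 1, by omega⟩ (t := 3) (by omega)
    have hlt := TypeIV.lt_of_isMinDist_six_mul_add_two hF hIV hn hmin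
    refine ⟨fun h => ?_, fun h => ?_⟩
    · refine l0 (by omega) (by omega) (TypeIV.not_regular_six_mul_add_two hF hIV hn hmin ?_)
      interval_cases m <;> simp_all
    · refine l4 (by omega) (by omega) (by omega)
        (TypeIV.not_regular_six_mul_add_two hF hIV hn hmin ?_)
      subst h; simp
  · rw [show 2 * (n / 6) + 2 = 2 * m + 2 by omega] at hmin
    obtain ⟨l0, l2, l3, l4⟩ := TypeIV.deltaSEq_ladder hF hIV hmin ⟨m + 1, by ring⟩
      ⟨3 * m + 2, by omega⟩ (t := 1) (by omega)
    refine ⟨fun h => ?_, fun h => ?_, fun h => ?_, fun h => ?_⟩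
    · refine l0 (by omega) (by omega) ?_
      -- For m = 2 the divisibility holds: C(6,2)·168 = 2520 is 7 times 3·C(16,2) = 360. The
      -- separate argument for length 16 is needed.
      by_cases hm2 : m = 2
      · subst hm2
        subst hn
        exact TypeIV.not_regular_sixteen hF hIV hmin
      · refine TypeIV.not_regular_six_mul_add_four hF hIV hn hmin ?_
        rcases h with rfl | rfl | rfl | rfl <;> simp_all
    · refine l2 (by omega) (by omega) (TypeIV.not_regular_six_mul_add_four hF hIV hn hmin ?_)
      rcases h with rfl | rfl | rfl | rfl | rfl | rfl | rfl | rfl | rfl | rfl | rfl | rfl | rfl | rfl <;>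
        simp
    · refine l3 (by omega) (by omega) (TypeIV.not_regular_six_mul_add_four hF hIV hn hmin ?_)
      subst h; simp
    · refine l4 (by omega) (by omega) (by omega)
        (TypeIV.not_regular_six_mul_add_four hF hIV hn hmin ?_)
      rcases h with rfl | rfl <;> simp
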